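/- Let $n\ge 0$ and let $\mathbb{R}^n\oplus\mathbb{R}^{n*}$ carry the symplectic form $\omega$ that vanishes on $\mathbb{R}^n$ and on $\mathbb{R}^{n*}$ and satisfies $\omega(v,\xi)=\langle v,\xi\rangle$. A subspace is Lagrangian if it is $n$-dimensional and $\omega$-isotropic. Let $V_\lambda\subseteq\Lambda^n(\mathbb{R}^n\oplus\mathbb{R}^{n*})$ be the smallest linear subspace containing $l_1\wedge\dots\wedge l_n$ for every basis $l_1,\dots,l_n$ of every Lagrangian subspace, and let $X_n\subseteq\mathbb{P}V_\lambda$ be the Lagrangian Grassmannian, i.e. the image of the Plücker map $\langle l_1,\dots,l_n\rangle\mapsto[l_1\wedge\dots\wedge l_n]$ on the set of Lagrangian subspaces. For $w\in\Lambda^n(\mathbb{R}^n\oplus\mathbb{R}^{n*})$ and $0\le k\le n$ let $w_k$ be the component of $w$ in $\Lambda^{n-k}\mathbb{R}^n\otimes\Lambda^k\mathbb{R}^{n*}\cong\Lambda^k\mathbb{R}^{n*}\otimes\Lambda^k\mathbb{R}^{n*}$, regarded as a bilinear form on $\Lambda^k\mathbb{R}^n$; here $\Lambda^{n-k}\mathbb{R}^n\cong\Lambda^k\mathbb{R}^{n*}$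 through the standard volume form, with the signs normalised as follows: for $I=\{i_1<\dots<i_k\}$ and $J=\{j_1<\dots<j_k\}$, the number $w_k(e_I,e_J)$ is the value on $w$ of the $n$-form obtained from $e^1\wedge\dots\wedge e^n$ by replacing $e^{i_a}$ by the $j_a$-th coordinate of $\mathbb{R}^{n*}$, $a=1,\dots,k$. For a symmetric bilinear form $\alpha$ on $\mathbb{R}^n$ let $\alpha^{(k)}$ be the induced form on $\Lambda^k\mathbb{R}^n$, $\alpha^{(k)}(x_1\wedge\dots\wedge x_k,\,y_1\wedge\dots\wedge y_k)=\det(\alpha(x_i,y_j))$. Real projective varieties are understood classically: a projective variety is a nonempty, irreducible, Zariski closed subset of a real projective space; rational maps are given by homogeneous polynomial maps, not identically zero on the source; two such maps are birational inverses of each other if both composites are defined somewhere and are the identity wherever they are defined. **Theorem.** The Plücker map is injective, and $X_n$ is a projective variety in $\mathbb{P}V_\lambda$. An element $w\in V_\lambda$ is determined by its components $w_0,\dots,w_n$; the component $w_1$ is symmetric for $w\in V_\lambda$; and for every $(\lambda,\alpha)$ in $W_0:=\mathbb{R}\oplus S^2\mathbb{R}^{n*}$ there is $w\in V_\lambda$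 with $w_0=\lambda$, $w_1=\alpha$ and $w_k=0$ for $2\le k\le n$ (for $n=0$, where $W_0=\mathbb{R}$, the condition on $w_1$ is void), so that $W_0$ is a direct summand of $V_\lambda$ with projection $w\mapsto(w_0,w_1)$. There is a homogeneous polynomial map $p:W_0\to V_\lambda$ of degree $n$ with $$p(\lambda,\alpha)_k=\lambda^{n-k}\alpha^{(k)}\qquad(0\le k\le n),$$ i.e. $p:[\lambda:\alpha]\mapsto[\lambda^n:\lambda^{n-1}\alpha:\lambda^{n-2}\alpha^{(2)}:\dots:\alpha^{(n)}]$. The linear projection $\mathbb{P}V_\lambda\dashrightarrow\mathbb{P}W_0$ restricts to a birational map $X_n\dashrightarrow\mathbb{P}W_0$, and its inverse is $p$ (in particular $p$ takes values in $X_n$ wherever it is defined). Consequently the Lagrangian Grassmannian $X_n$ is rational: it is birational to a projective space $\mathbb{P}^d$ over $\mathbb{R}$. -/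

import Mathlib

open scoped LinearAlgebra.Projectivization Matrix

noncomputable section

/-! ### Classical projective algebraic geometry over `ℝ` -/

section ProjectiveGeometry

variable {V : Type*} [AddCommGroup V] [Module ℝ V] {W : Type*} [AddCommGroup W] [Module ℝ W]

/-- `F : V → W` is a homogeneous polynomial map of degree `d`: the restriction to the diagonal of
a `d`-linear map. (For finite-dimensional `V` this says that, in linear coordinates, the components
of `F` are homogeneous polynomials of degree `d`.) -/
def IsHomogeneousPolyMap (d : ℕ) (F : V → W) : Prop :=
  ∃ M : MultilinearMap ℝ (fun _ : Fin d => V) W, ∀ v, F v = M fun _ => v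

/-- Zariski closed subsets of `ℙ V`: the common zero loci of families of homogeneous polynomials. -/
def IsZariskiClosed (Z : Set (ℙ ℝ V)) : Prop :=
  ∃ S : Set (V → ℝ), (∀ f ∈ S, ∃ d : ℕ, IsHomogeneousPolyMap d f) ∧
    Z = {P | ∀ f ∈ S, f P.rep = 0}

/-- A (real) projective variety: a Zariski closed, irreducible subset of a projective space. -/
def IsProjectiveVariety (X : Set (ℙ ℝ V)) : Prop :=
  IsZariskiClosed X ∧ X.Nonempty ∧
    ∀ Z₁ Z₂ : Set (ℙ ℝ V), IsZariskiClosed Z₁ → IsZariskiClosed Z₂ →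
      X ⊆ Z₁ ∪ Z₂ → X ⊆ Z₁ ∨ X ⊆ Z₂

/-- The homogeneous polynomial map `F` represents a rational map `X ⇢ Y`, `[v] ↦ [F v]`, whose
domain contains the (nonempty) Zariski open set of the points of `X` where `F` does not vanish. -/
structure IsRationalMap (X : Set (ℙ ℝ V)) (Y : Set (ℙ ℝ W)) (F : V → W) : Prop where
  homogeneous : ∃ d : ℕ, IsHomogeneousPolyMap d F
  nonempty_domain : ∃ P ∈ X, F P.rep ≠ 0
  mapsTo : ∀ P ∈ X, ∀ h : F P.rep ≠ 0, Projectivization.mk ℝ (F P.rep) h ∈ Y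

/-- `G ∘ F` is, as a rational map, the identity of `X`: the composite is defined somewhere on `X`,
and wherever it is defined it fixes the point. -/
def IsRationalLeftInverse (X : Set (ℙ ℝ V)) (F : V → W) (G : W → V) : Prop :=
  (∃ P ∈ X, F P.rep ≠ 0 ∧ G (F P.rep) ≠ 0) ∧
    ∀ P ∈ X, F P.rep ≠ 0 → ∀ h : G (F P.rep) ≠ 0, Projectivization.mk ℝ (G (F P.rep)) h = P

/-- `F` and `G` represent mutually inverse birational maps between the projective varieties
`X` and `Y`. -/
structure IsBirationalPair (X : Set (ℙ ℝ V)) (Y : Set (ℙ ℝ W)) (F : V → W) (G : W → V) :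
    Prop where
  variety_source : IsProjectiveVariety X
  variety_target : IsProjectiveVariety Y
  rational : IsRationalMap X Y F
  rational_inverse : IsRationalMap Y X G
  left_inverse : IsRationalLeftInverse X F G
  right_inverse : IsRationalLeftInverse Y G F

/-- A projective variety is rational if it is birational to some projective space `ℙ^d`. -/
def IsRationalVariety (X : Set (ℙ ℝ V)) : Prop :=
  ∃ (d : ℕ) (F : V → (Fin (d + 1) → ℝ)) (G : (Fin (d + 1) → ℝ) → V),
    IsBirationalPair X (Set.univ : Set (ℙ ℝ (Fin (d + 1) → ℝ))) F G

end ProjectiveGeometry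

/-! ### The Lagrangian Grassmannian and its minimal projective embedding -/

/-- The symplectic space `ℝⁿ ⊕ ℝⁿ*`; covectors are given by their coordinates in the dual basis. -/
abbrev SympSpace (n : ℕ) : Type := (Fin n → ℝ) × (Fin n → ℝ)

/-- The tautological symplectic form: `ω(v, α) = ⟨v, α⟩`, and `ω` vanishes on `ℝⁿ` and `ℝⁿ*`. -/
def sympForm (n : ℕ) (u v : SympSpace n) : ℝ := v.2 ⬝ᵥ u.1 - u.2 ⬝ᵥ v.1

/-- Lagrangian subspaces: the `n`-dimensional `ω`-isotropic subspaces of `ℝⁿ ⊕ ℝⁿ*`. -/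
def IsLagrangian (n : ℕ) (L : Submodule ℝ (SympSpace n)) : Prop :=
  Module.finrank ℝ L = n ∧ ∀ u ∈ L, ∀ v ∈ L, sympForm n u v = 0

/-- The space `V_λ ⊆ Λⁿ(ℝⁿ ⊕ ℝⁿ*)`: the smallest linear subspace containing the volume elements
`l₁ ∧ ⋯ ∧ lₙ` of all Lagrangian subspaces. -/
def plueckerSpan (n : ℕ) : Submodule ℝ (⋀[ℝ]^n (SympSpace n)) :=
  Submodule.span ℝ {w | ∃ L : Submodule ℝ (SympSpace n), IsLagrangian n L ∧
    ∃ b : Module.Basis (Fin n) ℝ L, w = exteriorPower.ιMulti ℝ n fun i => (b i : SympSpace n)}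

/-- The volume element `l₁ ∧ ⋯ ∧ lₙ` of a Lagrangian subspace, for some basis `l₁, …, lₙ`. -/
def plueckerVector (n : ℕ) (L : {L : Submodule ℝ (SympSpace n) // IsLagrangian n L}) :
    plueckerSpan n :=
  ⟨exteriorPower.ιMulti ℝ n fun i =>
      ((Module.finBasisOfFinrankEq ℝ L.1 L.2.1 i : L.1) : SympSpace n),
    Submodule.subset_span ⟨L.1, L.2, _, rfl⟩⟩

theorem ιMulti_ne_zero_of_linearIndependent {V : Type*} [AddCommGroup V] [Module ℝ V] {n : ℕ}
    {v : Fin n → V} (hv : LinearIndependent ℝ v) : exteriorPower.ιMulti ℝ n v ≠ 0 := by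
  have h := exteriorPower.ιMulti_family_linearIndependent_field n hv
  have h2 := h.ne_zero (Set.powersetCard.ofFinEmbEquiv ((OrderIso.refl (Fin n)).toOrderEmbedding : Fin n ↪o Fin n))
  simpa [exteriorPower.ιMulti_family] using h2

theorem plueckerVector_ne_zero (n : ℕ)
    (L : {L : Submodule ℝ (SympSpace n) // IsLagrangian n L}) : plueckerVector n L ≠ 0 := by
  intro h
  have h1 : exteriorPower.ιMulti ℝ n (fun i =>
      ((Module.finBasisOfFinrankEq ℝ L.1 L.2.1 i : L.1) : SympSpace n)) = 0 :=
    congrArg Subtype.val h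
  refine ιMulti_ne_zero_of_linearIndependent ?_ h1
  exact (Module.finBasisOfFinrankEq ℝ L.1 L.2.1).linearIndependent.map' L.1.subtype
    (Submodule.ker_subtype _)

/-- The Plücker map `L ↦ [l₁ ∧ ⋯ ∧ lₙ]` from the set of Lagrangian subspaces to `ℙ V_λ`. -/
def plueckerMap (n : ℕ) (L : {L : Submodule ℝ (SympSpace n) // IsLagrangian n L}) :
    ℙ ℝ (plueckerSpan n) :=
  Projectivization.mk ℝ (plueckerVector n L) (plueckerVector_ne_zero n L)

/-- The Lagrangian Grassmannian `X_n`, embedded in `ℙ V_λ`. -/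
def lagrangianGrassmannian (n : ℕ) : Set (ℙ ℝ (plueckerSpan n)) := Set.range (plueckerMap n)

/-! ### The graded pieces of `V_λ` and the projection to `W₀ = ℝ ⊕ S²ℝⁿ*` -/

/-- For `k`-subsets `I, J` of `{1, …, n}`, with increasing enumerations `i₁ < ⋯ < i_k` and
`j₁ < ⋯ < j_k`, the family of `n` linear forms on `ℝⁿ ⊕ ℝⁿ*` obtained from the coordinates
`e¹, …, eⁿ` on `ℝⁿ` by putting `e_{j_a}` (the `j_a`-th coordinate on `ℝⁿ*`) in the place of
`e^{i_a}`, for `a = 1, …, k`. -/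
def mixedCoframe (n k : ℕ) (I J : Set.powersetCard (Fin n) k) (i : Fin n) :
    Module.Dual ℝ (SympSpace n) :=
  open Classical in
  if h : ∃ a, Set.powersetCard.ofFinEmbEquiv.symm I a = i then
    LinearMap.proj (Set.powersetCard.ofFinEmbEquiv.symm J h.choose) ∘ₗ LinearMap.snd ℝ _ _
  else LinearMap.proj i ∘ₗ LinearMap.fst ℝ _ _

/-- The component of `w ∈ Λⁿ(ℝⁿ ⊕ ℝⁿ*)` in
`Λ^{n-k}ℝⁿ ⊗ Λ^kℝⁿ* ≅ Λ^kℝⁿ* ⊗ Λ^kℝⁿ*` (where `Λ^{n-k}ℝⁿ ≅ Λ^kℝⁿ*` through the standard volume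
form), as a bilinear form on `Λ^kℝⁿ`. Its value at `(e_I, e_J)` is the coordinate of `w` given by
the `n`-form `mixedCoframe n k I J 1 ∧ ⋯ ∧ mixedCoframe n k I J n`. -/
def formComponent (n k : ℕ) :
    ⋀[ℝ]^n (SympSpace n) →ₗ[ℝ] LinearMap.BilinForm ℝ (⋀[ℝ]^k (Fin n → ℝ)) where
  toFun w := Matrix.toLinearMap₂ ((Pi.basisFun ℝ (Fin n)).exteriorPower k)
    ((Pi.basisFun ℝ (Fin n)).exteriorPower k) (Matrix.of fun I J =>
      exteriorPower.pairingDual ℝ (SympSpace n) n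
        (exteriorPower.ιMulti ℝ n (mixedCoframe n k I J)) w)
  map_add' w w' := by
    rw [← map_add]; congr 1; ext I J; simp
  map_smul' c w := by
    rw [RingHom.id_apply, ← map_smul]; congr 1; ext I J; simp

/-- `S²ℝⁿ*`: the symmetric bilinear forms on `ℝⁿ`, given by their Gram matrices
`(α(e_a, e_b))_{a,b}`. -/
def symForms (n : ℕ) : Submodule ℝ (Matrix (Fin n) (Fin n) ℝ) where
  carrier := {A | A.IsSymm}
  add_mem' h h' := h.add h'
  zero_mem' := Matrix.isSymm_zero
  smul_mem' c _ h := h.smul c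

/-- `W₀ = ℝ ⊕ S²ℝⁿ*`. -/
abbrev WZero (n : ℕ) : Type := ℝ × symForms n

/-- The form `α^{(k)}` induced by `α` on `Λ^kℝⁿ`:
`α^{(k)}(x₁ ∧ ⋯ ∧ x_k, y₁ ∧ ⋯ ∧ y_k) = det (α(x_i, y_j))`. -/
def inducedForm (n k : ℕ) (A : Matrix (Fin n) (Fin n) ℝ) :
    LinearMap.BilinForm ℝ (⋀[ℝ]^k (Fin n → ℝ)) :=
  exteriorPower.pairingDual ℝ (Fin n → ℝ) k ∘ₗ exteriorPower.map k (Matrix.toBilin' A)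

/-- The component of `w` for `k = 0`, as a number: its value on `(1, 1)`, where `1 ∈ Λ⁰ℝⁿ = ℝ` is the empty product. -/
def scalarComponent (n : ℕ) : ⋀[ℝ]^n (SympSpace n) →ₗ[ℝ] ℝ where
  toFun w := formComponent n 0 w (exteriorPower.ιMulti ℝ 0 ![]) (exteriorPower.ιMulti ℝ 0 ![])
  map_add' w w' := by simp
  map_smul' c w := by simp

/-- The component of `w` for `k = 1`, as the Gram matrix of a bilinear form on `Λ¹ℝⁿ = ℝⁿ`. -/
def bilinComponent (n : ℕ) : ⋀[ℝ]^n (SympSpace n) →ₗ[ℝ] Matrix (Fin n) (Fin n) ℝ where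
  toFun w := Matrix.of fun a b => formComponent n 1 w
    (exteriorPower.ιMulti ℝ 1 ![Pi.single a 1]) (exteriorPower.ιMulti ℝ 1 ![Pi.single b 1])
  map_add' w w' := by ext; simp
  map_smul' c w := by ext; simp

/-- If `P, Q` are the two `n × n` blocks of a Lagrangian subspace, then `Q * adjugate P` is
symmetric. -/
theorem mul_adjugate_isSymm {n : ℕ} (P Q : Matrix (Fin n) (Fin n) ℝ) (h : Pᵀ * Q = Qᵀ * P)
    (hinj : ∀ u : Fin n → ℝ, P *ᵥ u = 0 → Q *ᵥ u = 0 → u = 0) :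
    (Q * P.adjugate).IsSymm := by
  -- pass to the generic Lagrangian subspace `P + X Q`
  set P' : Matrix (Fin n) (Fin n) (Polynomial ℝ) :=
    P.map Polynomial.C + (Polynomial.X : Polynomial ℝ) • Q.map Polynomial.C with hP'
  set Q' : Matrix (Fin n) (Fin n) (Polynomial ℝ) := Q.map Polynomial.C with hQ'
  have hsym : P'ᵀ * Q' = Q'ᵀ * P' := by
    have h0 : (P.map Polynomial.C)ᵀ * Q' = Q'ᵀ * P.map Polynomial.C := by
      have := congrArg (fun M : Matrix (Fin n) (Fin n) ℝ => M.map Polynomial.C) h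
      simpa [Matrix.map_mul, Matrix.transpose_map] using this
    simp only [hP', Matrix.transpose_add, Matrix.add_mul, Matrix.mul_add, h0,
      Matrix.transpose_smul, Matrix.smul_mul, Matrix.mul_smul]
  have hdet : P'.det ≠ 0 := by
    intro h0
    let ev : Polynomial ℝ →+* ℂ := Polynomial.eval₂RingHom Complex.ofRealHom Complex.I
    have h1 : (ev.mapMatrix P').det = 0 := by rw [← RingHom.map_det, h0, map_zero]
    have h2 : ev.mapMatrix P' =
        Complex.ofRealHom.mapMatrix P + Complex.I • Complex.ofRealHom.mapMatrix Q := by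
      ext i j; simp [hP', hQ', ev]; exact mul_comm _ _
    have h3 : (Complex.ofRealHom.mapMatrix Pᵀ - Complex.I • Complex.ofRealHom.mapMatrix Qᵀ) *
        ev.mapMatrix P' = Complex.ofRealHom.mapMatrix (Pᵀ * P + Qᵀ * Q) := by
      have h4 := congrArg Complex.ofRealHom.mapMatrix h
      simp only [map_mul] at h4
      rw [h2]
      rw [map_add, map_mul, map_mul, Matrix.sub_mul, Matrix.mul_add, Matrix.mul_add,
        Matrix.mul_smul, h4, Matrix.smul_mul, Matrix.smul_mul, Matrix.mul_smul, smul_smul,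
        Complex.I_mul_I]
      module
    have h5 : (Pᵀ * P + Qᵀ * Q).det = 0 := by
      have := congrArg Matrix.det h3
      rw [Matrix.det_mul, h1, mul_zero, ← RingHom.map_det] at this
      exact Complex.ofReal_eq_zero.mp this.symm
    obtain ⟨u, hu, hu0⟩ := Matrix.exists_mulVec_eq_zero_iff.mpr h5
    have h6 : (P *ᵥ u) ⬝ᵥ (P *ᵥ u) + (Q *ᵥ u) ⬝ᵥ (Q *ᵥ u) = 0 := by
      have := congrArg (fun w => u ⬝ᵥ w) hu0
      simpa [Matrix.add_mulVec, dotProduct_add, ← Matrix.mulVec_mulVec, Matrix.dotProduct_mulVec,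
        Matrix.vecMul_transpose] using this
    have nn : ∀ v : Fin n → ℝ, 0 ≤ v ⬝ᵥ v := fun v =>
      Finset.sum_nonneg fun i _ => mul_self_nonneg _
    have h7 := nn (P *ᵥ u)
    have h8 := nn (Q *ᵥ u)
    exact hu (hinj u (dotProduct_self_eq_zero.mp (by linarith))
      (dotProduct_self_eq_zero.mp (by linarith)))
  have hgen : (Q' * P'.adjugate)ᵀ = Q' * P'.adjugate := by
    have h1 : P'.adjugateᵀ * (P'ᵀ * Q') * P'.adjugate =
        P'.adjugateᵀ * (Q'ᵀ * P') * P'.adjugate := by rw [hsym]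
    have h2 : P'.adjugateᵀ * P'ᵀ = P'.det • (1 : Matrix (Fin n) (Fin n) (Polynomial ℝ)) := by
      rw [← Matrix.transpose_mul, Matrix.mul_adjugate]; simp
    have h3 : P'.det • (Q' * P'.adjugate) = P'.det • (Q' * P'.adjugate)ᵀ := by
      rw [Matrix.transpose_mul]
      calc P'.det • (Q' * P'.adjugate) = (P'.adjugateᵀ * P'ᵀ) * (Q' * P'.adjugate) := by
            rw [h2]; simp
        _ = P'.adjugateᵀ * (P'ᵀ * Q') * P'.adjugate := by simp only [Matrix.mul_assoc]
        _ = P'.adjugateᵀ * Q'ᵀ * (P' * P'.adjugate) := by rw [h1]; simp only [Matrix.mul_assoc]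
        _ = _ := by rw [Matrix.mul_adjugate]; simp
    ext1 i j
    have := congrFun (congrFun h3 i) j
    simp only [Matrix.smul_apply, smul_eq_mul] at this
    exact (mul_left_cancel₀ hdet this).symm
  let ev0 : Polynomial ℝ →+* ℝ := Polynomial.evalRingHom 0
  have e1 : ev0.mapMatrix P' = P := by ext i j; simp [hP', hQ', ev0]
  have e2 : ev0.mapMatrix Q' = Q := by ext i j; simp [hQ', ev0]
  have e3 : ev0.mapMatrix (Q' * P'.adjugate) = Q * P.adjugate := by
    rw [map_mul, RingHom.map_adjugate, e1, e2]
  have := congrArg ev0.mapMatrix hgen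
  rw [Matrix.IsSymm, ← e3]
  ext1 i j
  exact congrFun (congrFun this i) j


theorem bilinComponent_ιMulti {n : ℕ} (l : Fin n → SympSpace n) :
    bilinComponent n (exteriorPower.ιMulti ℝ n l) =
      ((Matrix.of fun i j => (l j).2 i) * (Matrix.of fun i j => (l j).1 i).adjugate)ᵀ := by
  set P : Matrix (Fin n) (Fin n) ℝ := Matrix.of fun i j => (l j).1 i with hP
  set Q : Matrix (Fin n) (Fin n) ℝ := Matrix.of fun i j => (l j).2 i with hQ
  ext a b
  let emb : Fin n → (Fin 1 ↪o Fin n) := fun a =>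
    OrderEmbedding.ofStrictMono (fun _ => a)
      (fun i j hij => absurd hij (by simp [Subsingleton.elim i j]))
  let I : Fin n → Set.powersetCard (Fin n) 1 := fun a => Set.powersetCard.ofFinEmbEquiv (emb a)
  have hI : ∀ a x, Set.powersetCard.ofFinEmbEquiv.symm (I a) x = a := by
    intro a x
    simp only [I, Equiv.symm_apply_apply]
    rfl
  have he : ∀ a : Fin n, exteriorPower.ιMulti ℝ 1 ![(Pi.single a 1 : Fin n → ℝ)] =
      (Pi.basisFun ℝ (Fin n)).exteriorPower 1 (I a) := by
    intro a
    rw [exteriorPower.basis_apply, exteriorPower.ιMulti_family]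
    congr 1
    ext x : 1
    simp [hI, Subsingleton.elim x 0]
  have h1 : bilinComponent n (exteriorPower.ιMulti ℝ n l) a b =
      (Matrix.of fun i j => mixedCoframe n 1 (I a) (I b) j (l i)).det := by
    simp only [bilinComponent, formComponent, LinearMap.coe_mk, AddHom.coe_mk, Matrix.of_apply,
      he, Matrix.toLinearMap₂_apply_basis, exteriorPower.pairingDual_ιMulti_ιMulti]
  have h2 : (Matrix.of fun i j => mixedCoframe n 1 (I a) (I b) j (l i)) =
      (P.updateRow a (Q b))ᵀ := by
    ext i j
    simp only [mixedCoframe, hI, Matrix.of_apply, Matrix.transpose_apply, Matrix.updateRow_apply]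
    by_cases h : j = a
    · subst h; simp [hQ]
    · have : ¬ a = j := fun h' => h h'.symm
      simp [h, this, hP]
  rw [h1, h2, Matrix.det_transpose, ← Matrix.cramer_transpose_apply,
    Matrix.cramer_eq_adjugate_mulVec, ← Matrix.adjugate_transpose]
  simp [Matrix.mulVec, Matrix.mul_apply, dotProduct, mul_comm]

theorem bilinComponent_mem_symForms (n : ℕ) (w : plueckerSpan n) :
    bilinComponent n (w : ⋀[ℝ]^n (SympSpace n)) ∈ symForms n := by
  have hle : plueckerSpan n ≤ (symForms n).comap (bilinComponent n) := by
    rw [plueckerSpan, Submodule.span_le]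
    rintro _ ⟨L, hL, b, rfl⟩
    show bilinComponent n _ ∈ symForms n
    rw [bilinComponent_ιMulti]
    refine Matrix.IsSymm.transpose (mul_adjugate_isSymm _ _ ?_ ?_)
    · ext i j
      have := hL.2 _ (b i).2 _ (b j).2
      simp only [sympForm, dotProduct] at this
      simp only [Matrix.mul_apply, Matrix.transpose_apply, Matrix.of_apply]
      rw [← sub_eq_zero, ← this]
      simp [mul_comm]
    · intro u h1 h2
      have h3 : ∑ i, u i • (b i : SympSpace n) = 0 := by
        ext i
        · have := congrFun h1 i
          simpa [Matrix.mulVec, dotProduct, Prod.fst_sum, mul_comm] using this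
        · have := congrFun h2 i
          simpa [Matrix.mulVec, dotProduct, Prod.snd_sum, mul_comm] using this
      have hb : LinearIndependent ℝ fun i => (b i : SympSpace n) :=
        b.linearIndependent.map' L.subtype (Submodule.ker_subtype _)
      funext i
      exact Fintype.linearIndependent_iff.mp hb u h3 i
  exact hle w.2

/-- The natural projection `V_λ → W₀ = ℝ ⊕ S²ℝⁿ*` onto the components `k = 0, 1`. -/
def projWZero (n : ℕ) : plueckerSpan n →ₗ[ℝ] WZero n :=
  (scalarComponent n ∘ₗ (plueckerSpan n).subtype).prod
    ((bilinComponent n ∘ₗ (plueckerSpan n).subtype).codRestrict (symForms n)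
      (bilinComponent_mem_symForms n))

end

/-!
The map `p(t, A) = ∧ᵢ (t eᵢ, A eᵢ)` (`chart`) sends `(1, A)` to the volume element of the graph of
the symmetric map `A : ℝⁿ → ℝⁿ*`. Its components are minors of the matrix with blocks `t • 1` and
`A` (`formComponent_chart`). The whole argument rests on one identity. Let the columns of `(P, Q)`
be an isotropic family `l`, and `w = l₁ ∧ ⋯ ∧ lₙ`. Then `w₀ = det P` and `w₁ = Q adj P`, so the
frame defining `p(w₀, w₁)` consists of the columns of `(P, Q) adj P`; hence
`p(w₀, w₁) = det (adj P) w`, without any condition on `P` (`IsIsotropicFamily.chart_projWZero`).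
Since the volume element of an isotropic family lies in `V_λ` and, if it does not vanish,
represents a point of `X_n`, this gives the birational correspondence in both directions
(`isBirationalPair_of_smul_eq`).

`X_n` is Zariski closed: by the identity, the cone over `X_n` satisfies the homogeneous equations
`w₀ p(w₀, w₁) = w₀ⁿ w`, and so do its images under all symplectic automorphisms `g`. Conversely,
let `w ≠ 0` satisfy the equations for all `g w`. The functionals `w ↦ (g w)₀` include, for the
standard scalar product on `Λⁿ`, the scalar products with the volume elements of all Lagrangian
subspaces; these span `V_λ`, and the scalar product is definite, so `(g w)₀ ≠ 0` for some `g`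
(`exists_symplectic_scalarComponent_ne_zero`). The equation for this `g` exhibits `g w` as a
multiple of a value of `p`, which puts the class of `w` into `X_n`.

`X_n` is irreducible: a homogeneous polynomial that does not vanish at some Lagrangian subspace does
not vanish at a graph, as one sees by moving the subspace by shears `(x, ξ) ↦ (x + t ξ, ξ)`
(`exists_chart_ne_zero`); and two polynomials which do not vanish at the graphs of `A₁` and `A₂`
have a common non-zero on the line through `A₁` and `A₂`.

Finally, the components of `w ∈ Λⁿ(ℝⁿ ⊕ ℝⁿ*)` are, up to sign, all its coordinates
(`exists_mixedCoframe_eq`), and `W₀ ⊆ V_λ` because `p(1, v vᵀ)` has no components with `k ≥ 2`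
and the forms `v vᵀ` span the symmetric forms.
-/

open scoped LinearAlgebra.Projectivization Matrix

noncomputable section

/-! ### Polynomial curves -/

section PolynomialCurves

variable {V : Type*} [AddCommGroup V] [Module ℝ V] {W : Type*} [AddCommGroup W] [Module ℝ W]

/-- `g : ℝ → V` is a polynomial curve: a finite sum of vectors with monomial coefficients. Several
summands may have the same exponent, which makes the notion visibly stable under multilinear
maps. -/
def IsPolynomialCurve (g : ℝ → V) : Prop :=
  ∃ (ι : Type) (_ : Fintype ι) (e : ι → ℕ) (c : ι → V), ∀ t, g t = ∑ i, t ^ e i • c i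

theorem isPolynomialCurve_line (u v : V) : IsPolynomialCurve fun t : ℝ => u + t • v :=
  ⟨Fin 2, inferInstance, ![0, 1], ![u, v], fun t => by simp [Fin.sum_univ_two]⟩

theorem IsPolynomialCurve.multilinear {d : ℕ} (M : MultilinearMap ℝ (fun _ : Fin d => V) W)
    {g : Fin d → ℝ → V} (hg : ∀ i, IsPolynomialCurve (g i)) :
    IsPolynomialCurve fun t => M fun i => g i t := by
  classical
  choose ι hι e c h using hg
  refine ⟨∀ i, ι i, inferInstance, fun r => ∑ i, e i (r i), fun r => M fun i => c i (r i),
    fun t => ?_⟩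
  simp only [h]
  rw [M.map_sum]
  refine Finset.sum_congr rfl fun r _ => ?_
  rw [M.map_smul_univ, Finset.prod_pow_eq_pow_sum]

theorem IsPolynomialCurve.linear (φ : V →ₗ[ℝ] W) {g : ℝ → V} (hg : IsPolynomialCurve g) :
    IsPolynomialCurve fun t => φ (g t) := by
  obtain ⟨ι, hι, e, c, h⟩ := hg
  exact ⟨ι, hι, e, fun i => φ (c i), fun t => by simp [h]⟩

theorem IsPolynomialCurve.exists_polynomial {g : ℝ → ℝ} (hg : IsPolynomialCurve g) :
    ∃ p : Polynomial ℝ, ∀ t, g t = p.eval t := by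
  obtain ⟨ι, hι, e, c, h⟩ := hg
  refine ⟨∑ i, Polynomial.C (c i) * Polynomial.X ^ e i, fun t => ?_⟩
  simp [h, Polynomial.eval_finsetSum, mul_comm (c _)]

theorem IsPolynomialCurve.exists_common_ne_zero {f g : ℝ → ℝ} (hf : IsPolynomialCurve f)
    (hg : IsPolynomialCurve g) {a b : ℝ} (ha : f a ≠ 0) (hb : g b ≠ 0) :
    ∃ t, f t ≠ 0 ∧ g t ≠ 0 := by
  obtain ⟨p, hp⟩ := hf.exists_polynomial
  obtain ⟨q, hq⟩ := hg.exists_polynomial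
  have hp0 : p ≠ 0 := by rintro rfl; simp [hp] at ha
  have hq0 : q ≠ 0 := by rintro rfl; simp [hq] at hb
  by_contra! h
  refine mul_ne_zero hp0 hq0 (Polynomial.funext fun t => ?_)
  rw [Polynomial.eval_mul, Polynomial.eval_zero, ← hp, ← hq]
  by_cases h0 : f t = 0
  · simp [h0]
  · simp [h t h0]

end PolynomialCurves

/-! ### Homogeneous polynomial maps -/

section HomogeneousMaps

variable {V : Type*} [AddCommGroup V] [Module ℝ V] {W : Type*} [AddCommGroup W] [Module ℝ W]
  {U : Type*} [AddCommGroup U] [Module ℝ U] {d : ℕ} {F G : V → W}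

namespace IsHomogeneousPolyMap

theorem map_smul (hF : IsHomogeneousPolyMap d F) (c : ℝ) (v : V) : F (c • v) = c ^ d • F v := by
  obtain ⟨M, hM⟩ := hF
  rw [hM, hM, M.map_smul_univ (fun _ => c) fun _ => v]
  simp

theorem linear_comp (φ : W →ₗ[ℝ] U) (hF : IsHomogeneousPolyMap d F) :
    IsHomogeneousPolyMap d fun v => φ (F v) := by
  obtain ⟨M, hM⟩ := hF
  exact ⟨φ.compMultilinearMap M, fun v => by simp [hM]⟩

theorem comp_linear (hF : IsHomogeneousPolyMap d F) (φ : U →ₗ[ℝ] V) :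
    IsHomogeneousPolyMap d fun u => F (φ u) := by
  obtain ⟨M, hM⟩ := hF
  exact ⟨M.compLinearMap fun _ => φ, fun v => by simp [hM]⟩

theorem linearForm_smul (φ : V →ₗ[ℝ] ℝ) (hF : IsHomogeneousPolyMap d F) :
    IsHomogeneousPolyMap (d + 1) fun v => φ v • F v := by
  obtain ⟨M, hM⟩ := hF
  exact ⟨LinearMap.uncurryLeft (M := fun _ : Fin (d + 1) => V) (φ.smulRight M),
    fun v => by simp [hM, Fin.tail_def]⟩

theorem sub (hF : IsHomogeneousPolyMap d F) (hG : IsHomogeneousPolyMap d G) :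
    IsHomogeneousPolyMap d fun v => F v - G v := by
  obtain ⟨M, hM⟩ := hF
  obtain ⟨N, hN⟩ := hG
  exact ⟨M - N, fun v => by simp [hM, hN]⟩

theorem of_linear (φ : V →ₗ[ℝ] W) : IsHomogeneousPolyMap 1 φ :=
  ⟨MultilinearMap.ofSubsingleton ℝ V W (0 : Fin 1) φ, fun v => by simp⟩

theorem linearForm_pow_smul (φ : V →ₗ[ℝ] ℝ) (hF : IsHomogeneousPolyMap d F) (m : ℕ) :
    IsHomogeneousPolyMap (d + m) fun v => φ v ^ m • F v := by
  induction m with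
  | zero => simpa using hF
  | succ m ih =>
    have := ih.linearForm_smul φ
    simpa only [smul_smul, ← pow_succ', add_assoc] using this

theorem polynomialCurve (hF : IsHomogeneousPolyMap d F) {g : ℝ → V} (hg : IsPolynomialCurve g) :
    IsPolynomialCurve fun t => F (g t) := by
  obtain ⟨M, hM⟩ := hF
  simpa only [hM] using IsPolynomialCurve.multilinear M fun _ => hg

/-- Whether a homogeneous polynomial map vanishes at a point of projective space does not depend
on the representative. -/
theorem map_rep_eq_zero_iff (hF : IsHomogeneousPolyMap d F) {v : V} (hv : v ≠ 0) :
    F (Projectivization.mk ℝ v hv).rep = 0 ↔ F v = 0 := by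
  obtain ⟨c, hc⟩ := Projectivization.exists_smul_eq_mk_rep ℝ v hv
  rw [← hc, Units.smul_def, hF.map_smul, smul_eq_zero_iff_right (pow_ne_zero _ c.ne_zero)]

end IsHomogeneousPolyMap

theorem isZariskiClosed_univ : IsZariskiClosed (Set.univ : Set (ℙ ℝ V)) :=
  ⟨∅, by simp, by simp⟩

/-- The common zero locus of homogeneous polynomial maps with values in a vector space is Zariski
closed. -/
theorem isZariskiClosed_of_eq_zero {κ : Type*} {G : κ → V → W}
    (hG : ∀ i, IsHomogeneousPolyMap d (G i)) :
    IsZariskiClosed {P : ℙ ℝ V | ∀ i, G i P.rep = 0} := by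
  refine ⟨{f | ∃ i, ∃ φ : Module.Dual ℝ W, f = fun v => φ (G i v)}, ?_, ?_⟩
  · rintro _ ⟨i, φ, rfl⟩
    exact ⟨d, (hG i).linear_comp φ⟩
  · ext P
    constructor
    · rintro hP _ ⟨i, φ, rfl⟩
      exact (congrArg φ (hP i)).trans (map_zero φ)
    · exact fun hP i => (Module.forall_dual_apply_eq_zero_iff ℝ _).mp fun φ => hP _ ⟨i, φ, rfl⟩

/-- A set of points is irreducible as soon as, for any two homogeneous polynomials that are not
identically zero on it, some point is a zero of neither. -/
theorem irreducible_of_common_ne_zero {X : Set (ℙ ℝ V)}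
    (h : ∀ (d₁ d₂ : ℕ) (f₁ f₂ : V → ℝ), IsHomogeneousPolyMap d₁ f₁ → IsHomogeneousPolyMap d₂ f₂ →
      (∃ P ∈ X, f₁ P.rep ≠ 0) → (∃ P ∈ X, f₂ P.rep ≠ 0) → ∃ P ∈ X, f₁ P.rep ≠ 0 ∧ f₂ P.rep ≠ 0)
    (Z₁ Z₂ : Set (ℙ ℝ V)) (h₁ : IsZariskiClosed Z₁) (h₂ : IsZariskiClosed Z₂)
    (hX : X ⊆ Z₁ ∪ Z₂) : X ⊆ Z₁ ∨ X ⊆ Z₂ := by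
  obtain ⟨S₁, hS₁, rfl⟩ := h₁
  obtain ⟨S₂, hS₂, rfl⟩ := h₂
  by_contra! hcon
  simp only [Set.not_subset, Set.mem_ofPred_eq, not_forall] at hcon
  obtain ⟨⟨P₁, hP₁, f₁, hf₁, hne₁⟩, P₂, hP₂, f₂, hf₂, hne₂⟩ := hcon
  obtain ⟨d₁, hd₁⟩ := hS₁ f₁ hf₁
  obtain ⟨d₂, hd₂⟩ := hS₂ f₂ hf₂
  obtain ⟨P, hP, hne, hne'⟩ := h d₁ d₂ f₁ f₂ hd₁ hd₂ ⟨P₁, hP₁, hne₁⟩ ⟨P₂, hP₂, hne₂⟩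
  rcases hX hP with hZ | hZ
  · exact hne (hZ f₁ hf₁)
  · exact hne' (hZ f₂ hf₂)

theorem isProjectiveVariety_univ [Nontrivial V] :
    IsProjectiveVariety (Set.univ : Set (ℙ ℝ V)) := by
  refine ⟨isZariskiClosed_univ, Set.univ_nonempty, irreducible_of_common_ne_zero ?_⟩
  rintro d₁ d₂ f₁ f₂ h₁ h₂ ⟨P₁, -, hP₁⟩ ⟨P₂, -, hP₂⟩
  -- join the two points by a line; a linear form `φ` keeps the line away from the origin
  obtain ⟨φ, hφ⟩ := Module.Projective.exists_dual_ne_zero ℝ P₁.rep_nonzero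
  have hline := isPolynomialCurve_line P₁.rep (P₂.rep - P₁.rep)
  have hmul : IsPolynomialCurve fun t : ℝ =>
      φ (P₁.rep + t • (P₂.rep - P₁.rep)) • f₁ (P₁.rep + t • (P₂.rep - P₁.rep)) :=
    (h₁.linearForm_smul φ).polynomialCurve hline
  obtain ⟨t, ht₁, ht₂⟩ := hmul.exists_common_ne_zero (h₂.polynomialCurve hline)
    (a := 0) (b := 1) (by simpa using ⟨hφ, hP₁⟩) (by simpa using hP₂)
  rw [smul_eq_mul, mul_ne_zero_iff] at ht₁
  have hv : P₁.rep + t • (P₂.rep - P₁.rep) ≠ 0 := fun h => ht₁.1 (by rw [h, map_zero])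
  exact ⟨.mk ℝ _ hv, trivial, (h₁.map_rep_eq_zero_iff hv).not.mpr ht₁.2,
    (h₂.map_rep_eq_zero_iff hv).not.mpr ht₂⟩

/-- A linear map `F` and a homogeneous polynomial map `G` are birational inverses of each other if
both composites are the identity up to scalar factors that do not all vanish. -/
theorem isBirationalPair_of_smul_eq [Nontrivial W] {X : Set (ℙ ℝ V)}
    (hX : IsProjectiveVariety X) (F : V →ₗ[ℝ] W) {G : W → V} (hG : IsHomogeneousPolyMap d G)
    (hGX : ∀ v, ∀ h : G v ≠ 0, Projectivization.mk ℝ (G v) h ∈ X)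
    (hGF : ∀ P ∈ X, ∃ c : ℝ, c • P.rep = G (F P.rep))
    (hFG : ∀ v ≠ 0, ∃ c : ℝ, c • v = F (G v))
    {u : W} (hu : u ≠ 0) (hFGu : F (G u) = u) :
    IsBirationalPair X (Set.univ : Set (ℙ ℝ W)) F G := by
  have hGu : G u ≠ 0 := fun h => hu (by rw [← hFGu, h, map_zero])
  have hF₁ := (IsHomogeneousPolyMap.of_linear F).map_rep_eq_zero_iff hGu
  have hG₁ := hG.map_rep_eq_zero_iff hu
  have hGF₁ := (hG.comp_linear F).map_rep_eq_zero_iff hGu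
  have hFG₁ := (hG.linear_comp F).map_rep_eq_zero_iff hu
  rw [hFGu] at hF₁ hGF₁ hFG₁
  refine ⟨hX, isProjectiveVariety_univ,
    ⟨⟨1, .of_linear F⟩, ⟨_, hGX u hGu, hF₁.not.mpr hu⟩, fun _ _ _ => trivial⟩,
    ⟨⟨d, hG⟩, ⟨_, trivial, hG₁.not.mpr hGu⟩, fun P _ h => hGX _ h⟩,
    ⟨⟨_, hGX u hGu, hF₁.not.mpr hu, hGF₁.not.mpr hGu⟩, fun P hP _ h => ?_⟩,
    ⟨⟨_, trivial, hG₁.not.mpr hGu, hFG₁.not.mpr hu⟩, fun P _ _ h => ?_⟩⟩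
  · conv_rhs => rw [← P.mk_rep]
    rw [Projectivization.mk_eq_mk_iff']
    exact hGF P hP
  · conv_rhs => rw [← P.mk_rep]
    rw [Projectivization.mk_eq_mk_iff']
    exact hFG _ P.rep_nonzero

theorem exists_projection_submodule (S : Submodule ℝ V) :
    ∃ q : V →ₗ[ℝ] S, ∀ w : S, q w = w := by
  obtain ⟨q, hq⟩ := S.subtype.exists_leftInverse_of_injective S.ker_subtype
  exact ⟨q, fun w => DFunLike.congr_fun hq w⟩

end HomogeneousMaps

/-! ### Exterior powers -/

section ExteriorPowers

variable {V : Type*} [AddCommGroup V] [Module ℝ V] {m n : ℕ}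

/-- A change of frame multiplies the volume element by the determinant. -/
theorem ιMulti_sum_smul (l : Fin n → V) (N : Matrix (Fin n) (Fin n) ℝ) :
    exteriorPower.ιMulti ℝ n (fun i => ∑ j, N j i • l j) =
      N.det • exteriorPower.ιMulti ℝ n l := by
  have key : (exteriorPower.ιMulti ℝ n).compLinearMap (Fintype.linearCombination ℝ l) =
      (LinearMap.toSpanSingleton ℝ _ (exteriorPower.ιMulti ℝ n l)).compAlternatingMap
        Matrix.detRowAlternating := by
    refine Module.Basis.ext_alternating (Pi.basisFun ℝ (Fin n)) fun v hv => ?_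
    let σ : Equiv.Perm (Fin n) := Equiv.ofBijective v (Finite.injective_iff_bijective.mp hv)
    have h1 : (fun i => (Fintype.linearCombination ℝ l) ((Pi.basisFun ℝ (Fin n)) (v i))) =
        l ∘ σ := by
      ext i
      simp [σ, Fintype.linearCombination_apply, Pi.single_apply]
    have h2 : (Matrix.detRowAlternating fun i => (Pi.basisFun ℝ (Fin n)) (v i)) =
        ((Equiv.Perm.sign σ : ℤ) : ℝ) := by
      rw [← Matrix.det_permutation]
      refine congrArg Matrix.det ?_
      ext i j
      simp [σ, Pi.single_apply, Equiv.Perm.permMatrix, PEquiv.toMatrix_apply, eq_comm]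
    rw [AlternatingMap.compLinearMap_apply, LinearMap.compAlternatingMap_apply, h2]
    erw [h1]
    rw [AlternatingMap.map_perm, LinearMap.toSpanSingleton_apply]
    rcases Int.units_eq_one_or (Equiv.Perm.sign σ) with h | h <;> simp [h]
  have hN : (Matrix.detRowAlternating Nᵀ : ℝ) = N.det := N.det_transpose
  refine Eq.trans (congrArg _ ?_) ((DFunLike.congr_fun key Nᵀ).trans ?_)
  · ext i
    simp [Fintype.linearCombination_apply]
  · exact congrArg (· • exteriorPower.ιMulti ℝ n l) hN

theorem linearIndependent_of_ιMulti_ne_zero {l : Fin n → V}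
    (h : exteriorPower.ιMulti ℝ n l ≠ 0) : LinearIndependent ℝ l := by
  by_contra hl
  exact h (AlternatingMap.map_linearDependent _ _ hl)

/-- A subspace is recovered from its volume element `w` as the set of the vectors `v` with
`v ∧ w = 0`; here, one inclusion. -/
theorem span_le_span_of_ιMulti_eq_smul {l l' : Fin n → V} (hl' : LinearIndependent ℝ l') (c : ℝ)
    (h : exteriorPower.ιMulti ℝ n l' = c • exteriorPower.ιMulti ℝ n l) :
    Submodule.span ℝ (Set.range l) ≤ Submodule.span ℝ (Set.range l') := by
  rw [Submodule.span_le]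
  rintro _ ⟨i, rfl⟩
  by_contra hi
  have hind : LinearIndependent ℝ (Fin.cons (l i) l' : Fin (n + 1) → V) :=
    linearIndependent_finCons.mpr ⟨hl', hi⟩
  have hcons : ∀ f : Fin n → V, ((exteriorPower.ιMulti ℝ (n + 1) (Fin.cons (l i) f) :
      ⋀[ℝ]^(n + 1) V) : ExteriorAlgebra ℝ V) =
        ExteriorAlgebra.ι ℝ (l i) * (exteriorPower.ιMulti ℝ n f : ⋀[ℝ]^n V) := by
    intro f
    rw [exteriorPower.ιMulti_apply_coe, ExteriorAlgebra.ιMulti_succ_apply,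
      exteriorPower.ιMulti_apply_coe]
    simp [Matrix.vecTail, Function.comp_def]
  refine ιMulti_ne_zero_of_linearIndependent hind (Subtype.ext ?_)
  have hrep : exteriorPower.ιMulti ℝ (n + 1) (Fin.cons (l i) l : Fin (n + 1) → V) = 0 :=
    (exteriorPower.ιMulti ℝ (n + 1)).map_eq_zero_of_eq (i := 0) (j := i.succ) _ (by simp)
      (Fin.succ_ne_zero i).symm
  rw [hcons, h, Submodule.coe_smul, mul_smul_comm, ← hcons, hrep]
  simp

theorem pairingDual_map (f : Fin n → Module.Dual ℝ V) (g : V →ₗ[ℝ] V) (w : ⋀[ℝ]^n V) :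
    exteriorPower.pairingDual ℝ V n (exteriorPower.ιMulti ℝ n f) (exteriorPower.map n g w) =
      exteriorPower.pairingDual ℝ V n (exteriorPower.ιMulti ℝ n fun i => f i ∘ₗ g) w := by
  rw [← LinearMap.comp_apply]
  refine DFunLike.congr_fun (exteriorPower.linearMap_ext ?_) w
  ext v
  simp [exteriorPower.pairingDual_ιMulti_ιMulti]

variable {ι : Type*}

theorem eq_zero_of_pairingDual_coord (b : Module.Basis ι ℝ V) (w : ⋀[ℝ]^n V)
    (h : ∀ f : Fin n → ι, Function.Injective f → exteriorPower.pairingDual ℝ V n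
      (exteriorPower.ιMulti ℝ n fun i => b.coord (f i)) w = 0) : w = 0 := by
  classical
  let : LinearOrder ι := linearOrderOfSTO WellOrderingRel
  refine (b.exteriorPower n).ext_elem fun s => ?_
  rw [exteriorPower.basis_repr_apply, map_zero, Finsupp.zero_apply]
  exact h _ (Set.powersetCard.ofFinEmbEquiv.symm s).injective

/-- The scalar product on an exterior power for which the products of the elements of a basis are
orthonormal is definite. -/
theorem eq_zero_of_pairingDual_toDual_self [Finite ι] [DecidableEq ι] (b : Module.Basis ι ℝ V)
    (w : ⋀[ℝ]^n V)
    (h : exteriorPower.pairingDual ℝ V n (exteriorPower.map n b.toDual w) w = 0) : w = 0 := by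
  classical
  let : LinearOrder ι := linearOrderOfSTO WellOrderingRel
  have := Fintype.ofFinite ι
  have := Fintype.ofFinite (Set.powersetCard ι n)
  let B := b.exteriorPower n
  have hB : ∀ s, exteriorPower.pairingDual ℝ V n (exteriorPower.map n b.toDual (B s)) w =
      B.repr w s := by
    intro s
    rw [exteriorPower.basis_repr_apply, exteriorPower.basis_apply,
      exteriorPower.map_apply_ιMulti_family, exteriorPower.ιMultiDual]
    congr 3
    ext i : 1
    simp [Module.Basis.coe_toDual_self]
  have hsum : exteriorPower.pairingDual ℝ V n (exteriorPower.map n b.toDual w) w =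
      ∑ s, B.repr w s * B.repr w s := by
    conv_lhs => enter [1]; rw [← B.sum_repr w]
    simp only [map_sum, map_smul, LinearMap.sum_apply, LinearMap.smul_apply, hB, smul_eq_mul]
  rw [h] at hsum
  refine B.ext_elem fun s => ?_
  have := (Finset.sum_eq_zero_iff_of_nonneg fun s _ => mul_self_nonneg (B.repr w s)).mp hsum.symm s
    (Finset.mem_univ s)
  simpa using this

end ExteriorPowers

/-! ### Isotropic families and the cone over the Lagrangian Grassmannian -/

section Isotropic

variable {n : ℕ}

theorem dotProduct_self_nonneg_real (v : Fin n → ℝ) : 0 ≤ v ⬝ᵥ v :=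
  Finset.sum_nonneg fun _ _ => mul_self_nonneg _

/-- The symplectic form `sympForm` as a bilinear form. -/
def sympBilin (n : ℕ) : LinearMap.BilinForm ℝ (SympSpace n) :=
  LinearMap.mk₂ ℝ (sympForm n)
    (fun u u' v => by simp only [sympForm, Prod.fst_add, Prod.snd_add, dotProduct_add,
      add_dotProduct]; ring)
    (fun c u v => by simp only [sympForm, Prod.smul_fst, Prod.smul_snd, dotProduct_smul,
      smul_dotProduct, smul_eq_mul]; ring)
    (fun u v v' => by simp only [sympForm, Prod.fst_add, Prod.snd_add, dotProduct_add,
      add_dotProduct]; ring)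
    (fun c u v => by simp only [sympForm, Prod.smul_fst, Prod.smul_snd, dotProduct_smul,
      smul_dotProduct, smul_eq_mul]; ring)

theorem sympBilin_apply (u v : SympSpace n) : sympBilin n u v = sympForm n u v := rfl

/-- `n` pairwise `ω`-orthogonal vectors of `ℝⁿ ⊕ ℝⁿ*`. -/
def IsIsotropicFamily (l : Fin n → SympSpace n) : Prop :=
  ∀ i j, sympForm n (l i) (l j) = 0

theorem IsIsotropicFamily.isLagrangian_span {l : Fin n → SympSpace n} (hl : IsIsotropicFamily l)
    (hli : LinearIndependent ℝ l) : IsLagrangian n (Submodule.span ℝ (Set.range l)) := by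
  refine ⟨by rw [finrank_span_eq_card hli, Fintype.card_fin], fun u hu v hv => ?_⟩
  rw [← sympBilin_apply]
  induction hu, hv using Submodule.span_induction₂ with
  | mem_mem x y hx hy =>
    obtain ⟨i, rfl⟩ := hx
    obtain ⟨j, rfl⟩ := hy
    exact hl i j
  | zero_left y hy => simp
  | zero_right x hx => simp
  | add_left x y z _ _ _ h₁ h₂ => rw [map_add, LinearMap.add_apply, h₁, h₂, add_zero]
  | add_right x y z _ _ _ h₁ h₂ => rw [map_add, h₁, h₂, add_zero]
  | smul_left r x y _ _ h => rw [map_smul, LinearMap.smul_apply, h, smul_zero]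
  | smul_right r x y _ _ h => rw [map_smul, h, smul_zero]

/-- The volume element of an isotropic family lies in `V_λ`: it is that of a Lagrangian subspace,
or it vanishes. -/
theorem IsIsotropicFamily.ιMulti_mem {l : Fin n → SympSpace n} (hl : IsIsotropicFamily l) :
    exteriorPower.ιMulti ℝ n l ∈ plueckerSpan n := by
  by_cases h : exteriorPower.ιMulti ℝ n l = 0
  · rw [h]
    exact zero_mem _
  · have hli := linearIndependent_of_ιMulti_ne_zero h
    refine Submodule.subset_span ⟨_, hl.isLagrangian_span hli, Module.Basis.span hli, ?_⟩
    congr 1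
    ext i : 1
    rw [Module.Basis.span_apply]

/-- A point of `ℙ V_λ` represented by the volume element of an isotropic family lies in `X_n`. -/
theorem IsIsotropicFamily.mk_mem {l : Fin n → SympSpace n} (hl : IsIsotropicFamily l)
    {w : plueckerSpan n} (hw : w ≠ 0) {c : ℝ}
    (h : (w : ⋀[ℝ]^n (SympSpace n)) = c • exteriorPower.ιMulti ℝ n l) :
    Projectivization.mk ℝ w hw ∈ lagrangianGrassmannian n := by
  have hι : exteriorPower.ιMulti ℝ n l ≠ 0 := by
    intro h0
    rw [h0, smul_zero] at h
    exact hw (Subtype.ext h)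
  have hli := linearIndependent_of_ιMulti_ne_zero hι
  let L : {L : Submodule ℝ (SympSpace n) // IsLagrangian n L} := ⟨_, hl.isLagrangian_span hli⟩
  have hb : ∀ i, ∃ c : Fin n → ℝ, ∑ j, c j • l j =
      ((Module.finBasisOfFinrankEq ℝ L.1 L.2.1 i : L.1) : SympSpace n) := fun i =>
    (Submodule.mem_span_range_iff_exists_fun ℝ).mp (Module.finBasisOfFinrankEq ℝ L.1 L.2.1 i).2
  choose N hN using hb
  have hvec : (plueckerVector n L : ⋀[ℝ]^n (SympSpace n)) =
      (Matrix.of N)ᵀ.det • exteriorPower.ιMulti ℝ n l := by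
    rw [← ιMulti_sum_smul]
    simp [plueckerVector, hN]
  have hdet : (Matrix.of N)ᵀ.det ≠ 0 := by
    intro h0
    rw [h0, zero_smul] at hvec
    exact plueckerVector_ne_zero n L (Subtype.ext hvec)
  refine ⟨L, ?_⟩
  rw [plueckerMap, Projectivization.mk_eq_mk_iff']
  have hc : c ≠ 0 := by
    rintro rfl
    rw [zero_smul] at h
    exact hw (Subtype.ext h)
  refine ⟨(Matrix.of N)ᵀ.det * c⁻¹, Subtype.ext ?_⟩
  rw [Submodule.coe_smul, h, hvec, smul_smul, mul_assoc, inv_mul_cancel₀ hc, mul_one]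

theorem exists_isotropic_of_mem {P : ℙ ℝ (plueckerSpan n)} (hP : P ∈ lagrangianGrassmannian n) :
    ∃ (l : Fin n → SympSpace n) (c : ℝ), IsIsotropicFamily l ∧ c ≠ 0 ∧
      LinearIndependent ℝ l ∧
      (P.rep : ⋀[ℝ]^n (SympSpace n)) = c • exteriorPower.ιMulti ℝ n l := by
  obtain ⟨L, rfl⟩ := hP
  obtain ⟨c, hc⟩ := Projectivization.exists_smul_eq_mk_rep ℝ (plueckerVector n L)
    (plueckerVector_ne_zero n L)
  refine ⟨fun i => (Module.finBasisOfFinrankEq ℝ L.1 L.2.1 i : L.1), c, fun i j =>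
    L.2.2 _ (Subtype.prop _) _ (Subtype.prop _), c.ne_zero,
    (Module.finBasisOfFinrankEq ℝ L.1 L.2.1).linearIndependent.map' L.1.subtype
      (Submodule.ker_subtype _), ?_⟩
  rw [plueckerMap, ← hc]
  rfl

theorem plueckerMap_injective (n : ℕ) : Function.Injective (plueckerMap n) := by
  have hspan : ∀ L : {L : Submodule ℝ (SympSpace n) // IsLagrangian n L},
      Submodule.span ℝ (Set.range fun i =>
        ((Module.finBasisOfFinrankEq ℝ L.1 L.2.1 i : L.1) : SympSpace n)) = L.1 := by
    intro L
    have := congrArg (Submodule.map L.1.subtype) (Module.finBasisOfFinrankEq ℝ L.1 L.2.1).span_eq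
    rw [Submodule.map_span, Submodule.map_subtype_top, ← Set.range_comp] at this
    exact this
  have hle : ∀ L L' : {L : Submodule ℝ (SympSpace n) // IsLagrangian n L},
      plueckerMap n L = plueckerMap n L' → L.1 ≤ L'.1 := by
    intro L L' h
    rw [plueckerMap, plueckerMap, eq_comm, Projectivization.mk_eq_mk_iff'] at h
    obtain ⟨c, hc⟩ := h
    rw [← hspan L, ← hspan L']
    refine span_le_span_of_ιMulti_eq_smul
      ((Module.finBasisOfFinrankEq ℝ L'.1 L'.2.1).linearIndependent.map' L'.1.subtype
        (Submodule.ker_subtype _)) c ?_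
    exact (congrArg Subtype.val hc).symm
  exact fun L L' h => Subtype.ext (le_antisymm (hle L L' h) (hle L' L h.symm))

/-! ### The action of the symplectic group on `V_λ` -/

theorem map_mem_plueckerSpan {g : SympSpace n →ₗ[ℝ] SympSpace n}
    (hg : ∀ u v, sympForm n (g u) (g v) = sympForm n u v) :
    ∀ w ∈ plueckerSpan n, exteriorPower.map n g w ∈ plueckerSpan n := by
  suffices plueckerSpan n ≤ (plueckerSpan n).comap (exteriorPower.map n g) from this
  conv_lhs => rw [plueckerSpan]
  rw [Submodule.span_le]
  rintro _ ⟨L, hL, b, rfl⟩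
  rw [SetLike.mem_coe, Submodule.mem_comap, exteriorPower.map_apply_ιMulti]
  refine IsIsotropicFamily.ιMulti_mem fun i j => ?_
  exact (hg _ _).trans (hL.2 _ (b i).2 _ (b j).2)

/-- The action on `V_λ` of a linear map that preserves the symplectic form. -/
def sympAction (g : SympSpace n →ₗ[ℝ] SympSpace n)
    (hg : ∀ u v, sympForm n (g u) (g v) = sympForm n u v) : plueckerSpan n →ₗ[ℝ] plueckerSpan n :=
  (exteriorPower.map n g).restrict (map_mem_plueckerSpan hg)

theorem coe_sympAction (g : SympSpace n →ₗ[ℝ] SympSpace n)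
    (hg : ∀ u v, sympForm n (g u) (g v) = sympForm n u v) (w : plueckerSpan n) :
    (sympAction g hg w : ⋀[ℝ]^n (SympSpace n)) = exteriorPower.map n g w := rfl

theorem sympForm_nondegenerate {u : SympSpace n} (h : ∀ v, sympForm n u v = 0) : u = 0 := by
  have h1 := h (-u.2, u.1)
  simp only [sympForm, dotProduct_neg, sub_neg_eq_add] at h1
  have := dotProduct_self_nonneg_real u.1
  have := dotProduct_self_nonneg_real u.2
  exact Prod.ext (dotProduct_self_eq_zero.mp (by linarith))
    (dotProduct_self_eq_zero.mp (by linarith))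

end Isotropic

/-! ### Components of elements of `Λⁿ(ℝⁿ ⊕ ℝⁿ*)` -/

section Components

variable {n k : ℕ}

theorem mixedCoframe_apply_mem (I J : Set.powersetCard (Fin n) k) (a : Fin k) :
    mixedCoframe n k I J (Set.powersetCard.ofFinEmbEquiv.symm I a) =
      LinearMap.proj (Set.powersetCard.ofFinEmbEquiv.symm J a) ∘ₗ LinearMap.snd ℝ _ _ := by
  have h : ∃ b, Set.powersetCard.ofFinEmbEquiv.symm I b =
      Set.powersetCard.ofFinEmbEquiv.symm I a := ⟨a, rfl⟩
  have h' : h.choose = a := (Set.powersetCard.ofFinEmbEquiv.symm I).injective h.choose_spec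
  rw [mixedCoframe, dif_pos h, h']

theorem mixedCoframe_apply_notMem (I J : Set.powersetCard (Fin n) k) {i : Fin n}
    (hi : ¬ ∃ a, Set.powersetCard.ofFinEmbEquiv.symm I a = i) :
    mixedCoframe n k I J i = LinearMap.proj i ∘ₗ LinearMap.fst ℝ _ _ := by
  rw [mixedCoframe, dif_neg hi]

theorem formComponent_basis (w : ⋀[ℝ]^n (SympSpace n)) (I J : Set.powersetCard (Fin n) k) :
    formComponent n k w ((Pi.basisFun ℝ (Fin n)).exteriorPower k I)
      ((Pi.basisFun ℝ (Fin n)).exteriorPower k J) =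
      exteriorPower.pairingDual ℝ (SympSpace n) n
        (exteriorPower.ιMulti ℝ n (mixedCoframe n k I J)) w := by
  simp only [formComponent, LinearMap.coe_mk, AddHom.coe_mk, Matrix.toLinearMap₂_apply_basis,
    Matrix.of_apply]

theorem inducedForm_basis (A : Matrix (Fin n) (Fin n) ℝ) (I J : Set.powersetCard (Fin n) k) :
    inducedForm n k A ((Pi.basisFun ℝ (Fin n)).exteriorPower k I)
      ((Pi.basisFun ℝ (Fin n)).exteriorPower k J) =
      (Matrix.of fun i j => A (Set.powersetCard.ofFinEmbEquiv.symm I j)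
        (Set.powersetCard.ofFinEmbEquiv.symm J i)).det := by
  rw [inducedForm, LinearMap.comp_apply, exteriorPower.basis_apply, exteriorPower.basis_apply,
    exteriorPower.ιMulti_family, exteriorPower.ιMulti_family, exteriorPower.map_apply_ιMulti,
    exteriorPower.pairingDual_ιMulti_ιMulti]
  congr 1
  ext i j
  simp [Matrix.toBilin'_single]

theorem inducedForm_vecMulVec (hk : 2 ≤ k) (v u : Fin n → ℝ) :
    inducedForm n k (Matrix.vecMulVec v u) = 0 := by
  have : Nontrivial (Fin k) := Fin.nontrivial_iff_two_le.mpr hk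
  refine ((Pi.basisFun ℝ (Fin n)).exteriorPower k).ext fun I =>
    ((Pi.basisFun ℝ (Fin n)).exteriorPower k).ext fun J => ?_
  rw [inducedForm_basis, LinearMap.zero_apply, LinearMap.zero_apply,
    ← Matrix.det_vecMulVec (fun i => u (Set.powersetCard.ofFinEmbEquiv.symm J i))
      (fun j => v (Set.powersetCard.ofFinEmbEquiv.symm I j))]
  congr 1
  ext i j
  simp [Matrix.vecMulVec_apply, mul_comm]

/-- The standard basis of `ℝⁿ ⊕ ℝⁿ*`. -/
def sympBasis (n : ℕ) : Module.Basis (Fin n ⊕ Fin n) ℝ (SympSpace n) :=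
  (Pi.basisFun ℝ (Fin n)).prod (Pi.basisFun ℝ (Fin n))

theorem sympBasis_coord_inl (i : Fin n) :
    (sympBasis n).coord (Sum.inl i) = LinearMap.proj i ∘ₗ LinearMap.fst ℝ _ _ := by
  ext <;> simp [sympBasis]

theorem sympBasis_coord_inr (i : Fin n) :
    (sympBasis n).coord (Sum.inr i) = LinearMap.proj i ∘ₗ LinearMap.snd ℝ _ _ := by
  ext <;> simp [sympBasis]

theorem sympBasis_toDual (u v : SympSpace n) :
    (sympBasis n).toDual u v = u.1 ⬝ᵥ v.1 + u.2 ⬝ᵥ v.2 := by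
  rw [← (sympBasis n).sum_dual_apply_smul_coord ((sympBasis n).toDual u)]
  simp only [Fintype.sum_sum_type, LinearMap.add_apply, LinearMap.sum_apply, LinearMap.smul_apply,
    sympBasis_coord_inl, sympBasis_coord_inr, Module.Basis.toDual_apply_left, smul_eq_mul]
  simp [sympBasis, dotProduct]

/-- Up to their order, the families `mixedCoframe n k I J` are all the families of `n` distinct
coordinates of `ℝⁿ ⊕ ℝⁿ*`. -/
theorem exists_mixedCoframe_eq (f : Fin n → Fin n ⊕ Fin n) (hf : Function.Injective f) :
    ∃ k ≤ n, ∃ (I J : Set.powersetCard (Fin n) k) (σ : Equiv.Perm (Fin n)),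
      mixedCoframe n k I J = (fun i => (sympBasis n).coord (f i)) ∘ σ := by
  classical
  let T : Finset (Fin n ⊕ Fin n) := Finset.univ.image f
  have hT : T.card = n := by rw [Finset.card_image_of_injective _ hf, Finset.card_fin]
  have hcard := T.card_toLeft_add_card_toRight
  have hI : T.toLeftᶜ.card = T.toRight.card := by
    rw [Finset.card_compl, Fintype.card_fin]
    omega
  let I : Set.powersetCard (Fin n) T.toRight.card := ⟨T.toLeftᶜ, hI⟩
  let J : Set.powersetCard (Fin n) T.toRight.card := ⟨T.toRight, rfl⟩
  have hmem : ∀ i, (∃ a, Set.powersetCard.ofFinEmbEquiv.symm I a = i) ↔ i ∉ T.toLeft := by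
    intro i
    rw [← Finset.mem_compl]
    exact Set.powersetCard.mem_range_ofFinEmbEquiv_symm_iff_mem I i
  have hJ : ∀ a, Set.powersetCard.ofFinEmbEquiv.symm J a ∈ T.toRight := fun a =>
    (Set.powersetCard.mem_range_ofFinEmbEquiv_symm_iff_mem J _).mp ⟨a, rfl⟩
  have hex : ∀ i, ∃ s, mixedCoframe n _ I J i = (sympBasis n).coord (f s) ∧
      ((∃ a, Set.powersetCard.ofFinEmbEquiv.symm I a = i ∧
        f s = Sum.inr (Set.powersetCard.ofFinEmbEquiv.symm J a)) ∨ f s = Sum.inl i) := by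
    intro i
    by_cases hi : ∃ a, Set.powersetCard.ofFinEmbEquiv.symm I a = i
    · obtain ⟨a, rfl⟩ := hi
      obtain ⟨s, -, hs⟩ := Finset.mem_image.mp (Finset.mem_toRight.mp (hJ a))
      exact ⟨s, by rw [mixedCoframe_apply_mem, hs, sympBasis_coord_inr], Or.inl ⟨a, rfl, hs⟩⟩
    · have hi' := hi
      rw [hmem, not_not, Finset.mem_toLeft] at hi'
      obtain ⟨s, -, hs⟩ := Finset.mem_image.mp hi'
      exact ⟨s, by rw [mixedCoframe_apply_notMem I J hi, hs, sympBasis_coord_inl], Or.inr hs⟩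
  choose s hs hs' using hex
  have hinj : Function.Injective s := by
    intro i j hij
    rcases hs' i with ⟨a, rfl, ha⟩ | ha <;> rcases hs' j with ⟨b, rfl, hb⟩ | hb <;>
      rw [hij, hb] at ha
    · rw [(Set.powersetCard.ofFinEmbEquiv.symm J).injective (Sum.inr_injective ha)]
    · cases ha
    · cases ha
    · exact (Sum.inl_injective ha).symm
  exact ⟨_, by omega, I, J, Equiv.ofBijective s (Finite.injective_iff_bijective.mp hinj),
    funext hs⟩

theorem eq_zero_of_formComponent_eq_zero (w : ⋀[ℝ]^n (SympSpace n))
    (h : ∀ k ≤ n, formComponent n k w = 0) : w = 0 := by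
  refine eq_zero_of_pairingDual_coord (sympBasis n) w fun f hf => ?_
  obtain ⟨k, hk, I, J, σ, hσ⟩ := exists_mixedCoframe_eq f hf
  have := formComponent_basis w I J
  rw [h k hk, hσ, AlternatingMap.map_perm, LinearMap.zero_apply, LinearMap.zero_apply] at this
  rcases Int.units_eq_one_or (Equiv.Perm.sign σ) with hs | hs <;> rw [hs] at this <;>
    simpa [eq_comm] using this

theorem scalarComponent_eq_pairingDual (w : ⋀[ℝ]^n (SympSpace n)) :
    scalarComponent n w = exteriorPower.pairingDual ℝ (SympSpace n) n
      (exteriorPower.ιMulti ℝ n fun i => LinearMap.proj i ∘ₗ LinearMap.fst ℝ _ _) w := by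
  let I : Set.powersetCard (Fin n) 0 := ⟨∅, rfl⟩
  have hI : exteriorPower.ιMulti ℝ 0 ![] = (Pi.basisFun ℝ (Fin n)).exteriorPower 0 I := by
    rw [exteriorPower.basis_apply, exteriorPower.ιMulti_family]
    congr 1
    exact Subsingleton.elim _ _
  have hm : mixedCoframe n 0 I I = fun i => LinearMap.proj i ∘ₗ LinearMap.fst ℝ _ _ := by
    funext i
    exact mixedCoframe_apply_notMem I I fun ⟨a, _⟩ => a.elim0
  simp only [scalarComponent, LinearMap.coe_mk, AddHom.coe_mk, hI, formComponent_basis, hm]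

theorem scalarComponent_ιMulti (l : Fin n → SympSpace n) :
    scalarComponent n (exteriorPower.ιMulti ℝ n l) = (Matrix.of fun i j => (l j).1 i).det := by
  rw [scalarComponent_eq_pairingDual, exteriorPower.pairingDual_ιMulti_ιMulti,
    ← Matrix.det_transpose]
  rfl

end Components

/-! ### The chart `(t, A) ↦ ∧ᵢ (t eᵢ, A eᵢ)` -/

section Chart

variable {n : ℕ}

/-- The `i`-th vector `(t eᵢ, A eᵢ)` of the frame attached to `(t, A) ∈ W₀`. For `t = 1` it spans,
with the others, the graph of `A : ℝⁿ → ℝⁿ*`. -/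
def chartFrame (i : Fin n) : WZero n →ₗ[ℝ] SympSpace n :=
  ((LinearMap.fst ℝ ℝ (symForms n)).smulRight (Pi.single i 1)).prod
    (LinearMap.pi fun j => Matrix.entryLinearMap ℝ ℝ j i ∘ₗ (symForms n).subtype ∘ₗ
      LinearMap.snd ℝ ℝ (symForms n))

theorem chartFrame_fst (i : Fin n) (a : WZero n) :
    (chartFrame i a).1 = a.1 • Pi.single i (1 : ℝ) := rfl

theorem chartFrame_snd (i j : Fin n) (a : WZero n) :
    (chartFrame i a).2 j = (a.2 : Matrix (Fin n) (Fin n) ℝ) j i := rfl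

theorem isIsotropicFamily_chartFrame (a : WZero n) :
    IsIsotropicFamily fun i => chartFrame i a := by
  intro i j
  simp [sympForm, chartFrame_fst, chartFrame_snd, a.2.2.apply i j]

/-- The polynomial map `p : W₀ → V_λ`, `p(t, A) = ∧ᵢ (t eᵢ, A eᵢ)`. -/
def chart (a : WZero n) : plueckerSpan n :=
  ⟨exteriorPower.ιMulti ℝ n fun i => chartFrame i a, (isIsotropicFamily_chartFrame a).ιMulti_mem⟩

theorem coe_chart (a : WZero n) :
    (chart a : ⋀[ℝ]^n (SympSpace n)) = exteriorPower.ιMulti ℝ n fun i => chartFrame i a := rfl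

theorem isHomogeneousPolyMap_chart : IsHomogeneousPolyMap n (chart (n := n)) := by
  obtain ⟨q, hq⟩ := exists_projection_submodule (plueckerSpan n)
  exact ⟨q.compMultilinearMap
    ((exteriorPower.ιMulti ℝ n).toMultilinearMap.compLinearMap chartFrame),
    fun a => (hq (chart a)).symm⟩

theorem formComponent_chart (k : ℕ) (t : ℝ) (α : symForms n) :
    formComponent n k (chart (t, α)) = t ^ (n - k) • inducedForm n k α := by
  classical
  refine ((Pi.basisFun ℝ (Fin n)).exteriorPower k).ext fun I =>
    ((Pi.basisFun ℝ (Fin n)).exteriorPower k).ext fun J => ?_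
  rw [formComponent_basis, LinearMap.smul_apply, LinearMap.smul_apply, inducedForm_basis,
    coe_chart, exteriorPower.pairingDual_ιMulti_ιMulti]
  -- the columns outside of `I` are those of `t • 1`, so that the determinant is block triangular
  rw [Matrix.twoBlockTriangular_det' _
    (fun i => ∃ a, Set.powersetCard.ofFinEmbEquiv.symm I a = i) ?_]
  · let e : Fin k ≃ {i // ∃ a, Set.powersetCard.ofFinEmbEquiv.symm I a = i} :=
      Equiv.ofInjective _ (Set.powersetCard.ofFinEmbEquiv.symm I).injective
    rw [mul_comm, smul_eq_mul]
    congr 1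
    · have hcard : Fintype.card {i // ¬ ∃ a, Set.powersetCard.ofFinEmbEquiv.symm I a = i} =
          n - k := by
        rw [Fintype.card_subtype_compl, Fintype.card_fin, ← Fintype.card_congr e,
          Fintype.card_fin]
      have hdet : (t • (1 : Matrix {i // ¬ ∃ a, Set.powersetCard.ofFinEmbEquiv.symm I a = i}
          {i // ¬ ∃ a, Set.powersetCard.ofFinEmbEquiv.symm I a = i} ℝ)).det = t ^ (n - k) := by
        rw [Matrix.det_smul, Matrix.det_one, mul_one, hcard]
      rw [← hdet]
      congr 1
      ext i j
      simp [Matrix.toSquareBlockProp, mixedCoframe_apply_notMem I J j.2, chartFrame_fst,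
        Pi.single_apply, Matrix.one_apply, Subtype.ext_iff, eq_comm]
    · rw [← Matrix.det_submatrix_equiv_self e, ← Matrix.det_transpose]
      congr 1
      ext i j
      have he : ∀ a, (e a : Fin n) = Set.powersetCard.ofFinEmbEquiv.symm I a := fun a => rfl
      simp only [Matrix.toSquareBlockProp, Matrix.transpose_apply, Matrix.submatrix_apply,
        Matrix.of_apply, Matrix.toBlock_apply, he, mixedCoframe_apply_mem, LinearMap.comp_apply,
        LinearMap.snd_apply, LinearMap.proj_apply, chartFrame_snd]
      exact α.2.apply _ _
  · intro i hi j hj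
    have hij : i ≠ j := fun h => hj (h ▸ hi)
    simp [mixedCoframe_apply_notMem I J hj, chartFrame_fst, hij.symm]

theorem projWZero_apply (w : plueckerSpan n) :
    projWZero n w = (scalarComponent n w, ⟨bilinComponent n w, bilinComponent_mem_symForms n w⟩) :=
  rfl

theorem projWZero_chart (a : WZero n) :
    projWZero n (chart a) = (a.1 ^ n, a.1 ^ (n - 1) • a.2) := by
  have hP : (Matrix.of fun i j => (chartFrame j a).1 i) =
      a.1 • (1 : Matrix (Fin n) (Fin n) ℝ) := by
    ext i j
    simp [chartFrame_fst, Matrix.one_apply, Pi.single_apply]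
  have hQ : (Matrix.of fun i j => (chartFrame j a).2 i) =
      (a.2 : Matrix (Fin n) (Fin n) ℝ) := by
    ext i j
    simp [chartFrame_snd]
  rw [projWZero_apply]
  refine Prod.ext ?_ (Subtype.ext ?_)
  · change scalarComponent n (chart a : ⋀[ℝ]^n (SympSpace n)) = _
    rw [coe_chart, scalarComponent_ιMulti, hP, Matrix.det_smul, Matrix.det_one, mul_one,
      Fintype.card_fin]
  · simp only [coe_chart, bilinComponent_ιMulti, hP, hQ, Matrix.adjugate_smul,
      Matrix.adjugate_one, Fintype.card_fin, Matrix.mul_smul, mul_one, Matrix.transpose_smul]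
    exact congrArg _ a.2.2

/-- In terms of the blocks `P`, `Q` of an isotropic family `l`, the frame attached to its
components `(det P, Q adj P)` consists of the columns of `(P, Q) adj P`. -/
theorem IsIsotropicFamily.chartFrame_projWZero {l : Fin n → SympSpace n}
    (hl : IsIsotropicFamily l) (i : Fin n) :
    chartFrame i (projWZero n ⟨exteriorPower.ιMulti ℝ n l, hl.ιMulti_mem⟩) =
      ∑ j, (Matrix.of fun i j => (l j).1 i).adjugate j i • l j := by
  set P : Matrix (Fin n) (Fin n) ℝ := Matrix.of fun i j => (l j).1 i with hP
  set Q : Matrix (Fin n) (Fin n) ℝ := Matrix.of fun i j => (l j).2 i with hQ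
  have hsymm : bilinComponent n (exteriorPower.ιMulti ℝ n l) = Q * P.adjugate := by
    rw [← (bilinComponent_mem_symForms n ⟨_, hl.ιMulti_mem⟩ : Matrix.IsSymm _).eq,
      bilinComponent_ιMulti, Matrix.transpose_transpose]
  ext k
  · have h1 := congrFun (congrFun P.mul_adjugate k) i
    rw [Matrix.mul_apply] at h1
    rw [chartFrame_fst, projWZero_apply, Prod.fst_sum]
    simp only [scalarComponent_ιMulti, ← hP]
    simpa [hP, Matrix.one_apply, Pi.single_apply, mul_comm] using h1.symm
  · rw [chartFrame_snd, projWZero_apply, Prod.snd_sum]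
    simp [hsymm, Matrix.mul_apply, hQ, mul_comm]

/-- On the cone over `X_n`, composing the projection to `W₀` with `p` multiplies by
`det (adj P)`. -/
theorem IsIsotropicFamily.chart_projWZero {l : Fin n → SympSpace n}
    (hl : IsIsotropicFamily l) :
    chart (projWZero n ⟨exteriorPower.ιMulti ℝ n l, hl.ιMulti_mem⟩) =
      (Matrix.of fun i j => (l j).1 i).adjugate.det •
        (⟨exteriorPower.ιMulti ℝ n l, hl.ιMulti_mem⟩ : plueckerSpan n) := by
  refine Subtype.ext ?_
  simp only [coe_chart, hl.chartFrame_projWZero]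
  rw [ιMulti_sum_smul]
  rfl

end Chart

/-! ### The Lagrangian Grassmannian is Zariski closed -/

section Closed

variable {n : ℕ}

theorem mulVec_dotProduct_mulVec (C D : Matrix (Fin n) (Fin n) ℝ) (u v : Fin n → ℝ) :
    (C *ᵥ u) ⬝ᵥ (D *ᵥ v) = u ⬝ᵥ ((Cᵀ * D) *ᵥ v) := by
  rw [← Matrix.mulVec_mulVec, Matrix.dotProduct_mulVec u, Matrix.vecMul_transpose]

theorem sum_smul_eq_zero_of_mulVec {l : Fin n → SympSpace n} {u : Fin n → ℝ}
    (h₁ : (Matrix.of fun i j => (l j).1 i) *ᵥ u = 0)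
    (h₂ : (Matrix.of fun i j => (l j).2 i) *ᵥ u = 0) : ∑ i, u i • l i = 0 := by
  ext i
  · simpa [Matrix.mulVec, dotProduct, Prod.fst_sum, mul_comm] using congrFun h₁ i
  · simpa [Matrix.mulVec, dotProduct, Prod.snd_sum, mul_comm] using congrFun h₂ i

theorem IsIsotropicFamily.transpose_mul_comm {l : Fin n → SympSpace n}
    (hl : IsIsotropicFamily l) :
    (Matrix.of fun i j => (l j).1 i)ᵀ * (Matrix.of fun i j => (l j).2 i) =
      (Matrix.of fun i j => (l j).2 i)ᵀ * (Matrix.of fun i j => (l j).1 i) := by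
  ext i j
  have := hl i j
  simp only [sympForm, dotProduct] at this
  simp only [Matrix.mul_apply, Matrix.transpose_apply, Matrix.of_apply]
  rw [← sub_eq_zero, ← this]
  simp [mul_comm]

/-- The rotated vectors `(-lᵢ'', lᵢ')` attached to a basis `lᵢ = (lᵢ', lᵢ'')` of a Lagrangian
subspace are the images of the standard basis of `ℝⁿ*` under a symplectic map. -/
theorem IsIsotropicFamily.exists_symplectic {l : Fin n → SympSpace n}
    (hl : IsIsotropicFamily l) (hli : LinearIndependent ℝ l) :
    ∃ h : SympSpace n →ₗ[ℝ] SympSpace n, (∀ u v, sympForm n (h u) (h v) = sympForm n u v) ∧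
      ∀ i, h (0, Pi.single i 1) = (-(l i).2, (l i).1) := by
  set P : Matrix (Fin n) (Fin n) ℝ := Matrix.of fun i j => (l j).1 i with hP
  set Q : Matrix (Fin n) (Fin n) ℝ := Matrix.of fun i j => (l j).2 i with hQ
  have hPQ : Pᵀ * Q = Qᵀ * P := hl.transpose_mul_comm
  have hdet : (Pᵀ * P + Qᵀ * Q).det ≠ 0 := by
    intro h0
    obtain ⟨u, hu, hu0⟩ := Matrix.exists_mulVec_eq_zero_iff.mpr h0
    have h6 : (P *ᵥ u) ⬝ᵥ (P *ᵥ u) + (Q *ᵥ u) ⬝ᵥ (Q *ᵥ u) = 0 := by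
      rw [mulVec_dotProduct_mulVec, mulVec_dotProduct_mulVec, ← dotProduct_add,
        ← Matrix.add_mulVec, hu0, dotProduct_zero]
    have h7 := dotProduct_self_nonneg_real (P *ᵥ u)
    have h8 := dotProduct_self_nonneg_real (Q *ᵥ u)
    refine hu (funext fun i => Fintype.linearIndependent_iff.mp hli u
      (sum_smul_eq_zero_of_mulVec ?_ ?_) i)
    · exact dotProduct_self_eq_zero.mp (by linarith)
    · exact dotProduct_self_eq_zero.mp (by linarith)
  set S := Pᵀ * P + Qᵀ * Q with hS
  have hinv : ∀ x, S *ᵥ (S⁻¹ *ᵥ x) = x := fun x => by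
    rw [Matrix.mulVec_mulVec, Matrix.mul_nonsing_inv _ (isUnit_iff_ne_zero.mpr hdet),
      Matrix.one_mulVec]
  -- the columns of `(P, Q) S⁻¹` complete the rotated vectors to a symplectic basis
  let h : SympSpace n →ₗ[ℝ] SympSpace n :=
    ((P * S⁻¹).mulVecLin ∘ₗ LinearMap.fst ℝ _ _ - Q.mulVecLin ∘ₗ LinearMap.snd ℝ _ _).prod
      ((Q * S⁻¹).mulVecLin ∘ₗ LinearMap.fst ℝ _ _ + P.mulVecLin ∘ₗ LinearMap.snd ℝ _ _)
  have hh : ∀ u, h u = (P *ᵥ (S⁻¹ *ᵥ u.1) - Q *ᵥ u.2, Q *ᵥ (S⁻¹ *ᵥ u.1) + P *ᵥ u.2) := by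
    intro u
    simp only [Matrix.mulVec_mulVec]
    rfl
  have hsymm : ∀ (M : Matrix (Fin n) (Fin n) ℝ), Mᵀ = M → ∀ u v : Fin n → ℝ,
      u ⬝ᵥ (M *ᵥ v) = v ⬝ᵥ (M *ᵥ u) := by
    intro M hM u v
    rw [Matrix.dotProduct_mulVec, ← Matrix.mulVec_transpose, hM, dotProduct_comm]
  refine ⟨h, fun u v => ?_, fun i => ?_⟩
  · rw [hh, hh]
    set p := S⁻¹ *ᵥ u.1 with hp
    set q := S⁻¹ *ᵥ v.1 with hq
    have e1 : u.1 = (Pᵀ * P) *ᵥ p + (Qᵀ * Q) *ᵥ p := by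
      rw [← Matrix.add_mulVec, ← hS, hp, hinv]
    have e2 : v.1 = (Pᵀ * P) *ᵥ q + (Qᵀ * Q) *ᵥ q := by
      rw [← Matrix.add_mulVec, ← hS, hq, hinv]
    simp only [sympForm, add_dotProduct, dotProduct_sub, mulVec_dotProduct_mulVec, hPQ]
    rw [e1, e2]
    simp only [dotProduct_add]
    have hQQ := hsymm (Qᵀ * Q) (by simp)
    have hQP := hsymm (Qᵀ * P) (by rw [Matrix.transpose_mul, Matrix.transpose_transpose, hPQ])
    rw [hQP q p, hQP v.2 u.2, hQQ q u.2, hQQ p v.2]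
    ring
  · rw [hh]
    ext j <;> simp [hP, hQ]

/-- A vector of `V_λ` is not orthogonal to all the generators of `V_λ`. -/
theorem exists_pairingDual_toDual_ne_zero {w : plueckerSpan n} (hw : w ≠ 0) :
    ∃ l : Fin n → SympSpace n, IsIsotropicFamily l ∧ LinearIndependent ℝ l ∧
      exteriorPower.pairingDual ℝ (SympSpace n) n
        (exteriorPower.ιMulti ℝ n fun i => (sympBasis n).toDual (l i)) w ≠ 0 := by
  by_contra! hcon
  refine hw (Subtype.ext (eq_zero_of_pairingDual_toDual_self (sympBasis n) _ ?_))
  have hle : plueckerSpan n ≤ LinearMap.ker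
      ((exteriorPower.pairingDual ℝ (SympSpace n) n ∘ₗ
        exteriorPower.map n (sympBasis n).toDual).flip (w : ⋀[ℝ]^n (SympSpace n))) := by
    conv_lhs => rw [plueckerSpan]
    rw [Submodule.span_le]
    rintro _ ⟨L, hL, b, rfl⟩
    rw [SetLike.mem_coe, LinearMap.mem_ker, LinearMap.flip_apply, LinearMap.comp_apply,
      exteriorPower.map_apply_ιMulti]
    exact hcon _ (fun i j => hL.2 _ (b i).2 _ (b j).2)
      (b.linearIndependent.map' L.subtype (Submodule.ker_subtype _))
  exact hle w.2

/-- Every nonzero vector of `V_λ` is moved by a symplectic automorphism to a vector whose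
component of index `0` does not vanish. -/
theorem exists_symplectic_scalarComponent_ne_zero {w : plueckerSpan n} (hw : w ≠ 0) :
    ∃ e : SympSpace n ≃ₗ[ℝ] SympSpace n,
      (∀ u v, sympForm n (e u) (e v) = sympForm n u v) ∧
      scalarComponent n (exteriorPower.map n (e : SympSpace n →ₗ[ℝ] SympSpace n) w) ≠ 0 := by
  obtain ⟨l, hl, hli, hne⟩ := exists_pairingDual_toDual_ne_zero hw
  obtain ⟨h, hsymp, hsingle⟩ := hl.exists_symplectic hli
  have hinj : Function.Injective h := by
    rw [← LinearMap.ker_eq_bot, LinearMap.ker_eq_bot']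
    intro u hu
    refine sympForm_nondegenerate fun v => ?_
    rw [← hsymp, hu]
    simp [sympForm]
  let e := LinearEquiv.ofInjectiveEndo h hinj
  have he : ∀ u, h (e.symm u) = u := e.apply_symm_apply
  have hesymp : ∀ u v, sympForm n (e.symm u) (e.symm v) = sympForm n u v := fun u v => by
    rw [← hsymp, he, he]
  refine ⟨e.symm, hesymp, ?_⟩
  have hcoord : (fun i => (LinearMap.proj i ∘ₗ LinearMap.fst ℝ (Fin n → ℝ) (Fin n → ℝ)) ∘ₗ
      (e.symm : SympSpace n →ₗ[ℝ] SympSpace n)) = fun i => (sympBasis n).toDual (l i) := by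
    funext i
    refine LinearMap.ext fun u => ?_
    have h1 := hsymp (e.symm u) (0, Pi.single i 1)
    rw [he, hsingle] at h1
    simp only [sympForm, dotProduct_neg, single_one_dotProduct, dotProduct_zero, sub_zero,
      sub_neg_eq_add] at h1
    rw [sympBasis_toDual, dotProduct_comm (l i).2]
    exact h1.symm
  rw [scalarComponent_eq_pairingDual, pairingDual_map, hcoord]
  exact hne

/-- The difference of the two sides of the equation `w₀ p(w₀, w₁) = w₀ⁿ w` of the cone over `X_n`.
The factor `w₀` makes both sides homogeneous of degree `n + 1`, for `n = 0` too. -/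
def chartDefect (n : ℕ) (w : plueckerSpan n) : plueckerSpan n :=
  (projWZero n w).1 • chart (projWZero n w) - (projWZero n w).1 ^ n • w

theorem isHomogeneousPolyMap_chartDefect :
    IsHomogeneousPolyMap (n + 1) (chartDefect n) := by
  let φ : plueckerSpan n →ₗ[ℝ] ℝ := LinearMap.fst ℝ ℝ (symForms n) ∘ₗ projWZero n
  have h₁ := (isHomogeneousPolyMap_chart.comp_linear (projWZero n)).linearForm_smul
    (V := plueckerSpan n) φ
  have h₂ := (IsHomogeneousPolyMap.of_linear (V := plueckerSpan n) (W := plueckerSpan n)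
    LinearMap.id).linearForm_pow_smul (V := plueckerSpan n) φ n
  rw [add_comm] at h₂
  exact h₁.sub h₂

theorem isHomogeneousPolyMap_chartDefect_sympAction (g : SympSpace n →ₗ[ℝ] SympSpace n)
    (hg : ∀ u v, sympForm n (g u) (g v) = sympForm n u v) :
    IsHomogeneousPolyMap (n + 1) fun w => chartDefect n (sympAction g hg w) := by
  have h := isHomogeneousPolyMap_chartDefect (n := n)
  generalize chartDefect n = F at h ⊢
  exact h.comp_linear (U := plueckerSpan n) (sympAction g hg)

theorem IsIsotropicFamily.chartDefect_eq_zero {l : Fin n → SympSpace n}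
    (hl : IsIsotropicFamily l) :
    chartDefect n ⟨exteriorPower.ιMulti ℝ n l, hl.ιMulti_mem⟩ = 0 := by
  rw [chartDefect, hl.chart_projWZero, projWZero_apply]
  simp only [scalarComponent_ιMulti]
  rw [smul_smul, ← Matrix.det_mul, Matrix.mul_adjugate, Matrix.det_smul, Matrix.det_one, mul_one,
    Fintype.card_fin]
  exact sub_self (G := plueckerSpan n) _

theorem isZariskiClosed_lagrangianGrassmannian (n : ℕ) :
    IsZariskiClosed (lagrangianGrassmannian n) := by
  have hclosed := isZariskiClosed_of_eq_zero (V := plueckerSpan n) (W := plueckerSpan n)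
    fun g : {g : SympSpace n →ₗ[ℝ] SympSpace n //
      ∀ u v, sympForm n (g u) (g v) = sympForm n u v} =>
        isHomogeneousPolyMap_chartDefect_sympAction g.1 g.2
  convert hclosed using 1
  · ext P
    constructor
    · rintro hP ⟨g, hg⟩
      obtain ⟨l, c, hl, -, -, hrep⟩ := exists_isotropic_of_mem hP
      have hgl : IsIsotropicFamily (g ∘ l) := fun i j => (hg _ _).trans (hl i j)
      have hact : sympAction g hg P.rep =
          c • ⟨exteriorPower.ιMulti ℝ n (g ∘ l), hgl.ιMulti_mem⟩ := by
        refine Subtype.ext ?_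
        rw [coe_sympAction, hrep, map_smul, exteriorPower.map_apply_ιMulti]
        rfl
      simp only [hact]
      rw [isHomogeneousPolyMap_chartDefect.map_smul, hgl.chartDefect_eq_zero, smul_zero]
    · intro hP
      obtain ⟨e, he, hne⟩ := exists_symplectic_scalarComponent_ne_zero P.rep_nonzero
      let g : SympSpace n →ₗ[ℝ] SympSpace n := e
      have hzero : chartDefect n (sympAction g he P.rep) = 0 := hP ⟨g, he⟩
      set v := sympAction g he P.rep with hv
      set s := (projWZero n v).1 with hs
      have hs0 : s ≠ 0 := hne
      have hback : exteriorPower.map n (e.symm : SympSpace n →ₗ[ℝ] SympSpace n)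
          (v : ⋀[ℝ]^n (SympSpace n)) = P.rep := by
        rw [hv, coe_sympAction, ← LinearMap.comp_apply, ← exteriorPower.map_comp]
        simp [g]
      have hvchart : (v : ⋀[ℝ]^n (SympSpace n)) = ((s ^ n)⁻¹ * s) •
          exteriorPower.ιMulti ℝ n fun i => chartFrame i (projWZero n v) := by
        have h1 := congrArg Subtype.val (sub_eq_zero (G := plueckerSpan n).mp hzero)
        rw [← hs, Submodule.coe_smul, Submodule.coe_smul, coe_chart] at h1
        rw [mul_smul, h1, inv_smul_smul₀ (pow_ne_zero n hs0)]
      have hiso : IsIsotropicFamily (e.symm ∘ fun i => chartFrame i (projWZero n v)) := by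
        intro i j
        rw [← he]
        simpa using isIsotropicFamily_chartFrame (projWZero n v) i j
      rw [← P.mk_rep]
      refine hiso.mk_mem P.rep_nonzero (c := (s ^ n)⁻¹ * s) ?_
      rw [← hback, hvchart, map_smul, exteriorPower.map_apply_ιMulti]
      rfl

end Closed

/-! ### The Lagrangian Grassmannian is irreducible -/

section Irreducible

variable {n : ℕ}

/-- Some shear `(x, ξ) ↦ (x + t ξ, ξ)` makes a given Lagrangian subspace a graph over `ℝⁿ`. -/
theorem IsIsotropicFamily.exists_det_add_smul_ne_zero {l : Fin n → SympSpace n}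
    (hl : IsIsotropicFamily l) (hli : LinearIndependent ℝ l) :
    ∃ t : ℝ, ((Matrix.of fun i j => (l j).1 i) + t • Matrix.of fun i j => (l j).2 i).det ≠ 0 := by
  by_contra! hdet
  have hPQ := hl.transpose_mul_comm
  set P : Matrix (Fin n) (Fin n) ℝ := Matrix.of fun i j => (l j).1 i with hP
  set Q : Matrix (Fin n) (Fin n) ℝ := Matrix.of fun i j => (l j).2 i with hQ
  -- kernel vectors `u` for distinct values of `t` have nonzero orthogonal images `Q u`
  choose u hu hu0 using fun t : ℝ => Matrix.exists_mulVec_eq_zero_iff.mpr (hdet t)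
  have hPu : ∀ t, P *ᵥ u t = -(t • Q *ᵥ u t) := fun t => by
    have := hu0 t
    rw [Matrix.add_mulVec, Matrix.smul_mulVec] at this
    exact eq_neg_of_add_eq_zero_left this
  have hQu : ∀ t, Q *ᵥ u t ≠ 0 := fun t h0 => hu t (funext fun i =>
    Fintype.linearIndependent_iff.mp hli (u t)
      (sum_smul_eq_zero_of_mulVec (by rw [← hP, hPu, h0, smul_zero, neg_zero]) h0) i)
  have horth : ∀ s t, s ≠ t → (Q *ᵥ u s) ⬝ᵥ (Q *ᵥ u t) = 0 := by
    intro s t hst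
    have h1 : (P *ᵥ u s) ⬝ᵥ (Q *ᵥ u t) = (Q *ᵥ u s) ⬝ᵥ (P *ᵥ u t) := by
      rw [mulVec_dotProduct_mulVec, mulVec_dotProduct_mulVec, hPQ]
    rw [hPu, hPu, neg_dotProduct, dotProduct_neg, smul_dotProduct, dotProduct_smul, neg_inj,
      smul_eq_mul, smul_eq_mul] at h1
    by_contra h
    exact hst (mul_right_cancel₀ h h1)
  have hind : LinearIndependent ℝ fun t => Q *ᵥ u t := by
    refine LinearMap.linearIndependent_of_isOrthoᵢ (B := dotProductBilin ℝ ℝ) ?_ ?_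
    · intro s t hst
      exact horth s t hst
    · intro t ht
      exact hQu t (dotProduct_self_eq_zero.mp ht)
  exact not_finite_iff_infinite.mpr inferInstance hind.finite

/-- A homogeneous polynomial that does not vanish identically on `X_n` does not vanish identically
on the graphs of the symmetric maps `ℝⁿ → ℝⁿ*`. -/
theorem exists_chart_ne_zero {d : ℕ} {f : plueckerSpan n → ℝ} (hf : IsHomogeneousPolyMap d f)
    {P : ℙ ℝ (plueckerSpan n)} (hP : P ∈ lagrangianGrassmannian n) (hfP : f P.rep ≠ 0) :
    ∃ A : symForms n, f (chart (1, A)) ≠ 0 := by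
  obtain ⟨l, c, hl, hc, hli, hrep⟩ := exists_isotropic_of_mem hP
  let m : ℝ → Fin n → SympSpace n := fun t i => l i + t • ((l i).2, 0)
  have hm : ∀ t, IsIsotropicFamily (m t) := by
    intro t i j
    have := hl i j
    simp only [sympForm] at this
    simp only [m, sympForm, Prod.fst_add, Prod.snd_add, Prod.smul_fst, Prod.smul_snd, smul_zero,
      add_zero, dotProduct_add, dotProduct_smul]
    rw [dotProduct_comm (l j).2 (l i).2]
    linarith
  let v : ℝ → plueckerSpan n := fun t => ⟨exteriorPower.ιMulti ℝ n (m t), (hm t).ιMulti_mem⟩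
  have hv : IsPolynomialCurve v := by
    obtain ⟨q, hq⟩ := exists_projection_submodule (plueckerSpan n)
    have h := IsPolynomialCurve.linear (W := plueckerSpan n) q
      (IsPolynomialCurve.multilinear (exteriorPower.ιMulti ℝ n).toMultilinearMap
        fun i => isPolynomialCurve_line (l i) ((l i).2, 0))
    have hqv : v = fun t => q (exteriorPower.ιMulti ℝ n (m t)) := funext fun t => (hq (v t)).symm
    rw [hqv]
    exact h
  have hv0 : f (v 0) ≠ 0 := by
    intro h0
    have hm0 : m 0 = l := funext fun i => by simp only [m, zero_smul, add_zero]
    have : P.rep = c • v 0 := Subtype.ext (by rw [hrep, Submodule.coe_smul, ← hm0])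
    rw [this, hf.map_smul, h0, smul_zero] at hfP
    exact hfP rfl
  obtain ⟨t₀, ht₀⟩ := hl.exists_det_add_smul_ne_zero hli
  have hmt : ∀ t, (projWZero n (v t)).1 =
      ((Matrix.of fun i j => (l j).1 i) + t • Matrix.of fun i j => (l j).2 i).det := by
    intro t
    rw [projWZero_apply]
    simp only [v, scalarComponent_ιMulti]
    congr 1
  let φ : plueckerSpan n →ₗ[ℝ] ℝ := LinearMap.fst ℝ ℝ (symForms n) ∘ₗ projWZero n
  obtain ⟨t, hft, hst⟩ := (hf.polynomialCurve hv).exists_common_ne_zero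
    (IsPolynomialCurve.linear (V := plueckerSpan n) φ hv) hv0 (b := t₀)
     ((hmt t₀).trans_ne ht₀)
  set a := projWZero n (v t) with ha
  replace hst : a.1 ≠ 0 := hst
  refine ⟨a.1⁻¹ • a.2, fun h0 => ?_⟩
  have h1 : a = a.1 • ((1, a.1⁻¹ • a.2) : WZero n) := by
    ext1
    · simp
    · simp [smul_smul, mul_inv_cancel₀ hst]
  have h2 : f (chart a) = 0 := by
    rw [h1, isHomogeneousPolyMap_chart.map_smul, hf.map_smul, h0, smul_zero]
  rw [ha, (hm t).chart_projWZero, hf.map_smul, smul_eq_zero] at h2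
  refine h2.elim (fun h3 => ?_) hft
  have h4 : (Matrix.of fun i j => (m t j).1 i).det ≠ 0 := by
    rw [← scalarComponent_ιMulti]
    exact hst
  rw [Matrix.det_adjugate] at h3
  exact pow_ne_zero _ (pow_ne_zero _ h4) h3

theorem projWZero_chart_one (A : symForms n) : projWZero n (chart (1, A)) = (1, A) := by
  simp [projWZero_chart]

theorem chart_one_ne_zero (A : symForms n) : chart (1, A) ≠ 0 := by
  intro h
  have := projWZero_chart_one A
  rw [h, map_zero] at this
  exact zero_ne_one (congrArg Prod.fst this)

theorem mk_chart_mem {a : WZero n} (h : chart a ≠ 0) :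
    Projectivization.mk ℝ (chart a) h ∈ lagrangianGrassmannian n :=
  (isIsotropicFamily_chartFrame a).mk_mem h (c := 1) (by rw [one_smul, coe_chart])

theorem isProjectiveVariety_lagrangianGrassmannian (n : ℕ) :
    IsProjectiveVariety (lagrangianGrassmannian n) := by
  refine ⟨isZariskiClosed_lagrangianGrassmannian n, ⟨_, mk_chart_mem (chart_one_ne_zero 0)⟩,
    irreducible_of_common_ne_zero ?_⟩
  rintro d₁ d₂ f₁ f₂ h₁ h₂ ⟨P₁, hP₁, hf₁⟩ ⟨P₂, hP₂, hf₂⟩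
  obtain ⟨A₁, hA₁⟩ := exists_chart_ne_zero h₁ hP₁ hf₁
  obtain ⟨A₂, hA₂⟩ := exists_chart_ne_zero h₂ hP₂ hf₂
  have hline : IsPolynomialCurve fun s : ℝ => (chart (1, A₁ + s • (A₂ - A₁)) : plueckerSpan n) := by
    have := isHomogeneousPolyMap_chart.polynomialCurve
      (isPolynomialCurve_line ((1, A₁) : WZero n) (0, A₂ - A₁))
    simpa using this
  obtain ⟨s, hs₁, hs₂⟩ := (h₁.polynomialCurve hline).exists_common_ne_zero
    (h₂.polynomialCurve hline) (a := 0) (b := 1) (by simpa using hA₁) (by simpa using hA₂)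
  have hne := chart_one_ne_zero (A₁ + s • (A₂ - A₁))
  exact ⟨_, mk_chart_mem hne, (h₁.map_rep_eq_zero_iff hne).not.mpr hs₁,
    (h₂.map_rep_eq_zero_iff hne).not.mpr hs₂⟩

end Irreducible

/-! ### `W₀` as a direct summand of `V_λ` -/

section Summand

variable {n : ℕ}

/-- The rank one symmetric form `v vᵀ`. -/
def squareForm (v : Fin n → ℝ) : symForms n :=
  ⟨Matrix.vecMulVec v v, by
    change (Matrix.vecMulVec v v)ᵀ = _
    rw [Matrix.transpose_vecMulVec]⟩

/-- Polarisation: symmetric forms are combinations of rank one forms. -/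
theorem symForms_eq_sum (A : symForms n) :
    A = ∑ a, ∑ b, ((A : Matrix (Fin n) (Fin n) ℝ) a b / 2) •
      (squareForm (Pi.single a 1 + Pi.single b 1) - squareForm (Pi.single a 1) -
        squareForm (Pi.single b 1)) := by
  refine Subtype.ext (Matrix.ext fun i j => ?_)
  have hpol : ∀ a b : Fin n, (((A : Matrix (Fin n) (Fin n) ℝ) a b / 2) •
      (squareForm (Pi.single a 1 + Pi.single b 1) - squareForm (Pi.single a 1) -
        squareForm (Pi.single b 1)) : symForms n).1 i j =
      (if i = a then if j = b then (A : Matrix (Fin n) (Fin n) ℝ) a b / 2 else 0 else 0) +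
      (if j = a then if i = b then (A : Matrix (Fin n) (Fin n) ℝ) a b / 2 else 0 else 0) := by
    intro a b
    simp only [squareForm, Submodule.coe_smul, Submodule.coe_sub, Matrix.smul_apply,
      Matrix.sub_apply, Matrix.vecMulVec_apply, Pi.add_apply, Pi.single_apply, smul_eq_mul]
    split_ifs <;> ring
  simp only [AddSubmonoidClass.coe_finsetSum, Matrix.sum_apply, hpol, Finset.sum_add_distrib]
  simp [A.2.apply i j]

theorem exists_projWZero_eq (a : WZero n) :
    ∃ w : plueckerSpan n, projWZero n w = a ∧
      ∀ k, 2 ≤ k → k ≤ n → formComponent n k w = 0 := by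
  let K : Submodule ℝ (plueckerSpan n) :=
    { carrier := {w | ∀ k, 2 ≤ k → k ≤ n → formComponent n k w = 0}
      add_mem' := fun h h' k hk hkn => by
        rw [Submodule.coe_add, map_add, h k hk hkn, h' k hk hkn, add_zero]
      zero_mem' := fun k _ _ => by rw [ZeroMemClass.coe_zero, map_zero]
      smul_mem' := fun c w h k hk hkn => by
        rw [Submodule.coe_smul, map_smul, h k hk hkn, smul_zero] }
  suffices a ∈ K.map (projWZero n) by
    obtain ⟨w, hw, rfl⟩ := this
    exact ⟨w, rfl, hw⟩
  have hsq : ∀ v : Fin n → ℝ, ((1, squareForm v) : WZero n) ∈ K.map (projWZero n) := by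
    intro v
    refine ⟨chart (1, squareForm v), fun k hk _ => ?_, projWZero_chart_one _⟩
    rw [formComponent_chart]
    change _ • inducedForm n k (Matrix.vecMulVec v v) = 0
    rw [inducedForm_vecMulVec hk, smul_zero]
  have hone : ((1, 0) : WZero n) ∈ K.map (projWZero n) := by
    have h0 : squareForm (0 : Fin n → ℝ) = 0 := Subtype.ext (by simp [squareForm])
    simpa [h0] using hsq 0
  have hsq' : ∀ v : Fin n → ℝ, squareForm v ∈
      (K.map (projWZero n)).comap (LinearMap.inr ℝ ℝ (symForms n)) := by
    intro v
    simpa using sub_mem (hsq v) hone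
  have hA : a.2 ∈ (K.map (projWZero n)).comap (LinearMap.inr ℝ ℝ (symForms n)) := by
    rw [symForms_eq_sum a.2]
    exact sum_mem fun i _ => sum_mem fun j _ => Submodule.smul_mem _ _
      (sub_mem (sub_mem (hsq' _) (hsq' _)) (hsq' _))
  have ha : a = a.1 • ((1, 0) : WZero n) + LinearMap.inr ℝ ℝ (symForms n) a.2 := by
    ext1 <;> simp
  rw [ha]
  exact add_mem (Submodule.smul_mem _ _ hone) hA

end Summand

/-! ### The birational correspondence -/

section Birational

variable {n : ℕ}

theorem exists_smul_eq_projWZero_chart {a : WZero n} (ha : a ≠ 0) :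
    ∃ c : ℝ, c • a = projWZero n (chart a) := by
  obtain ⟨t, A⟩ := a
  rw [projWZero_chart]
  rcases n with _ | n
  · have hA : A = 0 := Subtype.ext (Matrix.ext fun i => i.elim0)
    subst hA
    have ht : t ≠ 0 := by
      rintro rfl
      exact ha rfl
    exact ⟨t⁻¹, by simp [ht]⟩
  · exact ⟨t ^ n, by simp [pow_succ]⟩

/-- The projection to `W₀` and `p` are mutually inverse, in any linear coordinates `e` on `W₀`. -/
theorem isBirationalPair_projWZero_chart {W : Type*} [AddCommGroup W] [Module ℝ W]
    (e : WZero n ≃ₗ[ℝ] W) :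
    IsBirationalPair (lagrangianGrassmannian n) (Set.univ : Set (ℙ ℝ W))
      (e.toLinearMap ∘ₗ projWZero n) (fun v => chart (e.symm v)) := by
  have : Nontrivial W := e.symm.toEquiv.nontrivial
  refine isBirationalPair_of_smul_eq (V := plueckerSpan n) (u := e (1, 0))
    (isProjectiveVariety_lagrangianGrassmannian n) _
    (isHomogeneousPolyMap_chart.comp_linear e.symm.toLinearMap) (fun v h => mk_chart_mem h)
    (fun P hP => ?_) (fun v hv => ?_) (by simp) ?_
  · obtain ⟨l, c, hl, hc, -, hrep⟩ := exists_isotropic_of_mem hP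
    have hP' : P.rep = c • ⟨exteriorPower.ιMulti ℝ n l, hl.ιMulti_mem⟩ := Subtype.ext hrep
    refine ⟨c ^ n * (Matrix.of fun i j => (l j).1 i).adjugate.det * c⁻¹, ?_⟩
    change _ = chart (e.symm (e (projWZero n P.rep)))
    rw [e.symm_apply_apply, hP', map_smul, isHomogeneousPolyMap_chart.map_smul,
      hl.chart_projWZero, smul_smul, smul_smul, inv_mul_cancel_right₀ hc]
  · obtain ⟨c, hc⟩ := exists_smul_eq_projWZero_chart (e.symm.map_ne_zero_iff.mpr hv)
    refine ⟨c, ?_⟩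
    change _ = e (projWZero n (chart (e.symm v)))
    rw [← hc, map_smul, e.apply_symm_apply]
  · change e (projWZero n (chart (e.symm (e (1, 0))))) = _
    rw [e.symm_apply_apply, projWZero_chart_one]

theorem isRationalVariety_lagrangianGrassmannian (n : ℕ) :
    IsRationalVariety (lagrangianGrassmannian n) := by
  have hpos : 0 < Module.finrank ℝ (WZero n) := Module.finrank_pos
  let e : WZero n ≃ₗ[ℝ] (Fin (Module.finrank ℝ (WZero n) - 1 + 1) → ℝ) :=
    LinearEquiv.ofFinrankEq _ _ (by rw [Module.finrank_fin_fun]; omega)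
  exact ⟨_, _, _, isBirationalPair_projWZero_chart e⟩

end Birational

end

theorem mainTheorem8 (n : ℕ) :
    -- the Plücker map identifies the set of Lagrangian subspaces with `X_n ⊆ ℙ V_λ`
    Function.Injective (plueckerMap n) ∧
    -- a vector of `V_λ` is determined by its components, and `W₀ = ℝ ⊕ S²ℝⁿ*` is the subspace of
    -- `V_λ` of the vectors whose components vanish for `k ≥ 2`
    (∀ w : plueckerSpan n, (∀ k ≤ n, formComponent n k w = 0) → w = 0) ∧
    (∀ a : WZero n, ∃ w : plueckerSpan n, projWZero n w = a ∧
      ∀ k, 2 ≤ k → k ≤ n → formComponent n k w = 0) ∧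
    -- the map `[t : α] ↦ [tⁿ : tⁿ⁻¹ α : ⋯ : α^{(n)}]` and the projection are birational inverses
    (∃ p : WZero n → plueckerSpan n,
      (∀ (t : ℝ) (α : symForms n), ∀ k ≤ n,
        formComponent n k (p (t, α)) = t ^ (n - k) • inducedForm n k α) ∧
      IsHomogeneousPolyMap n p ∧
      IsBirationalPair (lagrangianGrassmannian n) (Set.univ : Set (ℙ ℝ (WZero n)))
        (projWZero n) p) ∧
    IsRationalVariety (lagrangianGrassmannian n) :=
  ⟨plueckerMap_injective n,
    fun w h => Subtype.ext (eq_zero_of_formComponent_eq_zero (w : ⋀[ℝ]^n (SympSpace n)) h),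
    exists_projWZero_eq,
    ⟨chart, fun t α k _ => formComponent_chart k t α, isHomogeneousPolyMap_chart,
      isBirationalPair_projWZero_chart (LinearEquiv.refl ℝ (WZero n))⟩,
    isRationalVariety_lagrangianGrassmannian n⟩
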